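/- Let $\mathbb T=\mathbb R/2\pi\mathbb Z$ and $$\Omega=\{(\lambda,\Lambda,\eta,\xi)\in\mathbb T\times(0,\infty)\times\mathbb R^2:\ \eta^2+\xi^2<2\Lambda\},$$ $$\mathcal E_+=\Big\{(x,y)\in(\mathbb R^2\setminus\{0\})\times\mathbb R^2:\ \tfrac12|y|^2-\tfrac1{|x|}<0,\ \ x_1y_2-x_2y_1>0\Big\}.$$ For $a>0$, $0\le e<1$ and $l,g\in\mathbb T$ let $u\in\mathbb T$ be the unique solution of Kepler's equation $u-e\sin u=l$, let $R[g]$ be the rotation $\begin{pmatrix}\cos g&-\sin g\\ \sin g&\cos g\end{pmatrix}$, and let $\mathcal A(a,e,l,g)=(x,y)$ with $$x=R[g]\begin{pmatrix}a(\cos u-e)\\ a\sqrt{1-e^2}\,\sin u\end{pmatrix},\qquad y=R[g]\begin{pmatrix}-\dfrac{\sin u}{a^{1/2}(1-e\cos u)}\\[2mm] \dfrac{\sqrt{1-e^2}\,\cos u}{a^{1/2}(1-e\cos u)}\end{pmatrix}.$$ Define $\mathcal P:\Omega\to\mathbb R^2\times\mathbb R^2$ as follows. If $(\eta,\xi)\ne(0,0)$,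 write $\eta=\sqrt{2H}\sin h$, $\xi=\sqrt{2H}\cos h$ with $H>0$ and $h\in\mathbb T$, put $g=-h$, $l=\lambda-g$, $L=\Lambda$, $G=L-H$, and set $\mathcal P(\lambda,\Lambda,\eta,\xi)=\mathcal A(a,e,l,g)$, where $a=L^2$ and $e=\sqrt{1-G^2/L^2}$ (equivalently $L=\sqrt a$, $G=\sqrt{a(1-e^2)}$). If $\eta=\xi=0$, set $$\mathcal P(\lambda,\Lambda,0,0)=\big(\Lambda^2(\cos\lambda,\sin\lambda),\ \Lambda^{-1}(-\sin\lambda,\cos\lambda)\big).$$ **Proposition 3.1.** The map $\mathcal P$ is a real-analytic symplectic diffeomorphism of $\Omega$ onto $\mathcal E_+$: it maps $\Omega$ bijectively onto $\mathcal E_+$, it and its inverse are real analytic, and $$\mathcal P^*(dx_1\wedge dy_1+dx_2\wedge dy_2)=d\lambda\wedge d\Lambda+d\eta\wedge d\xi\quad\text{on }\Omega.$$ -/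

import Mathlib

open Real
open scoped Manifold ContDiff

noncomputable section

namespace PoincareCoordinates

/-! ### The circle `𝕋 = ℝ / 2πℤ` as a real-analytic manifold

`Real.Angle` is the quotient `ℝ / 2πℤ`. Its charts are the local inverses of the projection
`ℝ → ℝ / 2πℤ`, so the transition maps are locally translations and every chart identifies the
tangent space at a point with `ℝ` through the differential of the angular coordinate. -/

/-- The projection `ℝ → ℝ / 2πℤ`, restricted to the interval `(a, a + 2π)`. -/
def angleCoe (a : ℝ) : OpenPartialHomeomorph ℝ Real.Angle :=
  haveI : Fact ((0 : ℝ) < 2 * π) := ⟨Real.two_pi_pos⟩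
  (AddCircle.openPartialHomeomorphCoe (2 * π) a : OpenPartialHomeomorph ℝ (AddCircle (2 * π)))

lemma angleCoe_apply (a t : ℝ) : angleCoe a t = (t : Real.Angle) := rfl

lemma angleCoe_target (a : ℝ) : (angleCoe a).target = {(a : Real.Angle)}ᶜ := rfl

lemma mem_angleCoe_target (x : Real.Angle) : x ∈ (angleCoe (x.toReal - π)).target := by
  rw [angleCoe_target, Set.mem_compl_singleton_iff]
  intro h
  have h2 : ((π : ℝ) : Real.Angle) = 0 := by
    have h1 : x = x - ((π : ℝ) : Real.Angle) := by
      rw [Real.Angle.coe_sub, Real.Angle.coe_toReal] at h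
      exact h
    rw [eq_comm, sub_eq_self] at h1
    exact h1
  exact Real.Angle.pi_ne_zero h2

instance : ChartedSpace ℝ Real.Angle where
  atlas := Set.range fun a : ℝ => (angleCoe a).symm
  chartAt x := (angleCoe (x.toReal - π)).symm
  mem_chart_source x := mem_angleCoe_target x
  chart_mem_atlas x := ⟨x.toReal - π, rfl⟩

/-- Near each point that it covers, a chart undoes the projection up to a translation. -/
lemma angleCoe_symm_coe_eventuallyEq (b t : ℝ) (ht : (t : Real.Angle) ∈ (angleCoe b).target) :
    ∃ c : ℝ, ∀ᶠ s : ℝ in nhds t, (angleCoe b).symm (s : Real.Angle) = s + c := by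
  set f : ℝ → ℝ := fun s => (angleCoe b).symm (s : Real.Angle) with hf
  have hcont : ContinuousAt f t :=
    ((angleCoe b).continuousAt_symm ht).comp (f := fun s : ℝ => (s : Real.Angle))
      Real.Angle.continuous_coe.continuousAt
  have hcoe : ∀ᶠ s : ℝ in nhds t, ((f s : ℝ) : Real.Angle) = (s : Real.Angle) := by
    have hopen : ∀ᶠ s : ℝ in nhds t, (s : Real.Angle) ∈ (angleCoe b).target :=
      Real.Angle.continuous_coe.continuousAt.preimage_mem_nhds
        ((angleCoe b).open_target.mem_nhds ht)
    filter_upwards [hopen] with s hs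
    exact (angleCoe b).right_inv hs
  have hg : ContinuousAt (fun s => f s - s) t := hcont.sub continuousAt_id
  have hclose := Metric.continuousAt_iff'.mp hg (2 * π) Real.two_pi_pos
  refine ⟨f t - t, ?_⟩
  filter_upwards [hcoe, hclose] with s h1 h2
  obtain ⟨k, hk⟩ := Real.Angle.angle_eq_iff_two_pi_dvd_sub.mp h1
  obtain ⟨m, hm⟩ := Real.Angle.angle_eq_iff_two_pi_dvd_sub.mp hcoe.self_of_nhds
  rw [Real.dist_eq, hk, hm, ← mul_sub, abs_mul, abs_of_pos Real.two_pi_pos] at h2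
  have h3 : |((k - m : ℤ) : ℝ)| < 1 := by
    push_cast
    by_contra hcon
    nlinarith [Real.two_pi_pos, not_lt.mp hcon]
  have h4 : k - m = 0 := by
    rw [← Int.cast_abs] at h3
    exact Int.abs_lt_one_iff.mp (by exact_mod_cast h3)
  have h5 : k = m := by omega
  subst h5
  change f s = _
  linarith

/-- `ℝ / 2πℤ` is a real-analytic manifold. -/
instance : IsManifold 𝓘(ℝ, ℝ) ω Real.Angle := by
  apply isManifold_of_contDiffOn
  rintro _ _ ⟨a, rfl⟩ ⟨b, rfl⟩ t ht
  apply ContDiffAt.contDiffWithinAt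
  simp only [mfld_simps] at ht
  obtain ⟨c, hc⟩ := angleCoe_symm_coe_eventuallyEq b t ht.2
  have : ContDiffAt ℝ ω (fun s : ℝ => s + c) t := contDiffAt_id.add contDiffAt_const
  exact this.congr_of_eventuallyEq hc

/-- The projection `t ↦ t mod 2π` has derivative the identity: the coordinate of a tangent vector
of the circle in Mathlib's tangent space `ℝ` is its value under the `1`-form `dλ`. -/
lemma hasMFDerivAt_angleCoe (t : ℝ) :
    HasMFDerivAt 𝓘(ℝ, ℝ) 𝓘(ℝ, ℝ) (fun s : ℝ => (s : Real.Angle)) t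
      (ContinuousLinearMap.id ℝ ℝ) := by
  refine ⟨Real.Angle.continuous_coe.continuousAt, ?_⟩
  obtain ⟨c, hc⟩ := angleCoe_symm_coe_eventuallyEq _ t (mem_angleCoe_target (t : Real.Angle))
  have h : HasFDerivAt (fun s : ℝ => s + c) (ContinuousLinearMap.id ℝ ℝ) t :=
    (hasFDerivAt_id t).add_const c
  exact (h.congr_of_eventuallyEq hc).hasFDerivWithinAt

/-! ### Kepler states in the plane -/

/-- Pairs `(x, y)` (position, velocity) of the planar Kepler problem. -/
abbrev Phase : Type := EuclideanSpace ℝ (Fin 2) × EuclideanSpace ℝ (Fin 2)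

/-- `E(x, y) = |y|² / 2 - 1 / |x|`. -/
def energy (z : Phase) : ℝ := ‖z.2‖ ^ 2 / 2 - 1 / ‖z.1‖

/-- `M(x, y) = x₁ y₂ - x₂ y₁`. -/
def angularMomentum (z : Phase) : ℝ := z.1 0 * z.2 1 - z.1 1 * z.2 0

/-- `𝓔₊`: the states with `x ≠ 0`, negative energy and positive angular momentum. -/
def ellipticRegion : TopologicalSpace.Opens Phase where
  carrier := {z | z.1 ≠ 0 ∧ energy z < 0 ∧ 0 < angularMomentum z}
  is_open' := by
    have h1 : IsOpen {z : Phase | z.1 ≠ 0} := isOpen_ne_fun continuous_fst continuous_const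
    have hE : ContinuousOn energy {z : Phase | z.1 ≠ 0} := by
      unfold energy
      refine ContinuousOn.sub (by fun_prop) (ContinuousOn.div (by fun_prop) (by fun_prop) ?_)
      intro z hz
      exact norm_ne_zero_iff.mpr hz
    have hM : Continuous angularMomentum := by
      unfold angularMomentum
      fun_prop
    have h2 := (hE.isOpen_inter_preimage h1 (isOpen_Iio (a := (0 : ℝ)))).inter
      (isOpen_Ioi.preimage hM : IsOpen (angularMomentum ⁻¹' Set.Ioi 0))
    convert h2 using 1
    ext z
    simp [and_assoc]

/-! ### Astronomical and Delaunay coordinates -/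

/-- The map `u ↦ u - e sin u` of the circle. -/
def keplerMap (e : ℝ) (u : Real.Angle) : Real.Angle := u - ((e * u.sin : ℝ) : Real.Angle)

/-- The eccentric anomaly `u`: the solution of Kepler's equation `u - e sin u = l`, which
exists and is unique for `0 ≤ e < 1`. -/
def eccentricAnomaly (e : ℝ) (l : Real.Angle) : Real.Angle := Function.invFun (keplerMap e) l

/-- Kepler's equation is uniquely solvable for `0 ≤ e < 1`. -/
lemma keplerMap_bijective {e : ℝ} (he : 0 ≤ e) (he1 : e < 1) :
    Function.Bijective (keplerMap e) := by
  have hderiv : ∀ x : ℝ, HasDerivAt (fun s : ℝ => s - e * Real.sin s) (1 - e * Real.cos x) x :=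
    fun x => (hasDerivAt_id x).sub ((Real.hasDerivAt_sin x).const_mul e)
  have hmono : StrictMono fun s : ℝ => s - e * Real.sin s := by
    apply strictMono_of_deriv_pos
    intro x
    rw [(hderiv x).deriv]
    nlinarith [Real.cos_le_one x]
  have hlift : ∀ s : ℝ, keplerMap e (s : Real.Angle) = ((s - e * Real.sin s : ℝ) : Real.Angle) :=
    fun s => by simp [keplerMap]
  constructor
  · intro u v
    induction u using Real.Angle.induction_on with | _ u
    induction v using Real.Angle.induction_on with | _ v
    intro h
    rw [hlift, hlift] at h
    obtain ⟨k, hk⟩ := Real.Angle.angle_eq_iff_two_pi_dvd_sub.mp h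
    refine Real.Angle.angle_eq_iff_two_pi_dvd_sub.mpr ⟨k, ?_⟩
    have hs : Real.sin (v + 2 * π * k) = Real.sin v := by
      rw [mul_comm]
      exact Real.sin_add_int_mul_two_pi v k
    have : u = v + 2 * π * k := hmono.injective (by
      rw [hs]
      linarith)
    linarith
  · intro l
    induction l using Real.Angle.induction_on with | _ l
    have hc : Continuous fun s : ℝ => s - e * Real.sin s := by fun_prop
    have hm : l ∈ Set.Icc ((l - 1) - e * Real.sin (l - 1)) ((l + 1) - e * Real.sin (l + 1)) := by
      constructor <;>
        nlinarith [Real.sin_le_one (l + 1), Real.neg_one_le_sin (l - 1)]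
    obtain ⟨u, -, hu⟩ := intermediate_value_Icc (by linarith : l - 1 ≤ l + 1) hc.continuousOn hm
    exact ⟨(u : Real.Angle), by rw [hlift]; exact congrArg _ hu⟩

/-- The rotation `R[g]`. -/
def rotation (g : Real.Angle) (v : EuclideanSpace ℝ (Fin 2)) : EuclideanSpace ℝ (Fin 2) :=
  !₂[g.cos * v 0 - g.sin * v 1, g.sin * v 0 + g.cos * v 1]

/-- The state with semi-major axis `a`, eccentricity `e`, mean anomaly `l` and argument of the
pericentre `g`. -/
def astronomical (a e : ℝ) (l g : Real.Angle) : Phase :=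
  let u := eccentricAnomaly e l
  (rotation g !₂[a * (u.cos - e), a * √(1 - e ^ 2) * u.sin],
   rotation g !₂[-(u.sin / (√a * (1 - e * u.cos))),
     √(1 - e ^ 2) * u.cos / (√a * (1 - e * u.cos))])

/-- The state with Delaunay variables `L, G, l, g`, where `L = √a` and `G = √(a (1 - e²))`,
that is, `a = L²` and `e = √(1 - G² / L²)` when `0 < G ≤ L`. -/
def delaunay (L G : ℝ) (l g : Real.Angle) : Phase :=
  astronomical (L ^ 2) (√(1 - G ^ 2 / L ^ 2)) l g

/-- The state on the circular orbit of radius `a` at angle `θ`. -/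
def circularState (a : ℝ) (θ : Real.Angle) : Phase :=
  (!₂[a * θ.cos, a * θ.sin], !₂[-(θ.sin / √a), θ.cos / √a])

/-! ### Poincaré coordinates -/

/-- Quadruples `(λ, (Λ, η, ξ))` with `λ ∈ 𝕋 = ℝ / 2πℤ` and `Λ, η, ξ` real. -/
abbrev Coord : Type := Real.Angle × (ℝ × ℝ × ℝ)

/-- The manifold structure of `𝕋 × ℝ³` (product of that of `𝕋` and that of `ℝ³`). -/
abbrev coordModel : ModelWithCorners ℝ (ℝ × (ℝ × ℝ × ℝ)) (ModelProd ℝ (ℝ × ℝ × ℝ)) :=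
  𝓘(ℝ, ℝ).prod 𝓘(ℝ, ℝ × ℝ × ℝ)

/-- `Ω = {Λ > 0, η² + ξ² < 2 Λ}`. -/
def domain : TopologicalSpace.Opens Coord where
  carrier := {z | 0 < z.2.1 ∧ z.2.2.1 ^ 2 + z.2.2.2 ^ 2 < 2 * z.2.1}
  is_open' := by
    have h1 : IsOpen {z : Coord | 0 < z.2.1} := isOpen_lt (by fun_prop) (by fun_prop)
    have h2 : IsOpen {z : Coord | z.2.2.1 ^ 2 + z.2.2.2 ^ 2 < 2 * z.2.1} :=
      isOpen_lt (by fun_prop) (by fun_prop)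
    exact h1.inter h2

/-- The map `𝓟 : (λ, Λ, η, ξ) ↦ (x, y)`. For `(η, ξ) ≠ (0, 0)` it is obtained from the Delaunay
map through `λ = l + g`, `Λ = L`, `η = √(2H) sin h`, `ξ = √(2H) cos h`, `h = -g`, `H = L - G`;
the angle `h` is the argument of `ξ + i η`. For `η = ξ = 0` it is the state at angle `λ` of the
circular orbit of radius `Λ²`. -/
def poincareMap (z : Coord) : Phase :=
  let θ : Real.Angle := z.1
  let L : ℝ := z.2.1
  let η : ℝ := z.2.2.1
  let ξ : ℝ := z.2.2.2
  if η = 0 ∧ ξ = 0 then circularState (L ^ 2) θ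
  else
    let H : ℝ := (η ^ 2 + ξ ^ 2) / 2
    let h : Real.Angle := ((⟨ξ, η⟩ : ℂ).arg : ℝ)
    let g : Real.Angle := -h
    delaunay L (L - H) (θ - g) g

/-- The `2`-form `dλ ∧ dΛ + dη ∧ dξ` on `𝕋 × ℝ³`. -/
def coordForm (z : Coord) (v w : TangentSpace coordModel z) : ℝ :=
  let v' : ℝ × (ℝ × ℝ × ℝ) := v
  let w' : ℝ × (ℝ × ℝ × ℝ) := w
  (v'.1 * w'.2.1 - v'.2.1 * w'.1) + (v'.2.2.1 * w'.2.2.2 - v'.2.2.2 * w'.2.2.1)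

/-- The `2`-form `dx₁ ∧ dy₁ + dx₂ ∧ dy₂` on `ℝ² × ℝ²`. -/
def phaseForm (z : Phase) (v w : TangentSpace 𝓘(ℝ, Phase) z) : ℝ :=
  let v' : Phase := v
  let w' : Phase := w
  (v'.1 0 * w'.2 0 - v'.2 0 * w'.1 0) + (v'.1 1 * w'.2 1 - v'.2 1 * w'.1 1)

end PoincareCoordinates

end

noncomputable section

namespace PoincareCoordinates

/-! ### Levi-Civita form of the Poincaré map

With `r = (Λ, η, ξ)`, `σ = ξ - i η` and `u` the eccentric longitude, the state is
`x = Λ (α - β)²`, `y = i (α + β) / (Λ conj (α - β))` with `α = √(Λ - |σ|²/4) e^{iu/2}` and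
`β = (σ / 2) e^{-iu/2}`. -/

/-! The pericentre angle `g` is undefined on circular orbits; the Levi-Civita square root removes
this defect. With ℝ² = ℂ, σ = ξ - iη, c = α - β and d = α + β, `poincareMap_meanLongitude` shows
that 𝓟 is x = Λc², y = id/(Λ c̄), where λ = u - Im(c d̄)/Λ. The polar angle of σ has disappeared, so
σ = 0 is no longer special.

Bijectivity: energy -1/(2Λ²) means |c|² + |d|² = 2Λ, that is |α|² + |β|² = Λ, and the angular
momentum is |α|² - |β|², so positivity means |β| < |α|. A state determines Λ, then (c, d) up to a
common sign; α² and αβ do not see the sign and return u mod 2π and σ (`lc_injective`,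
`lc_surjective`).

Symplecticity: Re(dx ∧ dȳ) = 2 Im(dc ∧ dd̄) + dΛ ∧ d Im(c d̄)/Λ (`leviCivita_form`). The first term
is du ∧ dΛ + dη ∧ dξ (`im_lcAlphaDeriv_sub_lcBetaDeriv`), and the second turns du ∧ dΛ into dλ ∧ dΛ
by `meanLongitude_eq`.

Analyticity: ∂λ/∂u = |c|²/Λ > 0, so u is analytic in (λ, Λ, η, ξ) by the inverse function theorem,
and hence so is 𝓟 lifted to the universal cover. A symplectic derivative is injective, so local
inverses are analytic too, and global injectivity glues them. -/

/-- The triples `(Λ, η, ξ)` allowed in the domain of the Poincaré map. -/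
def shapeSet : Set (ℝ × ℝ × ℝ) := {r | 0 < r.1 ∧ r.2.1 ^ 2 + r.2.2 ^ 2 < 2 * r.1}

/-- The modulus `√(Λ - (η² + ξ²) / 4)` of the first Levi-Civita variable. -/
def lcRadius (r : ℝ × ℝ × ℝ) : ℝ := √(r.1 - (r.2.1 ^ 2 + r.2.2 ^ 2) / 4)

/-- The first Levi-Civita variable. -/
def lcAlpha (u : ℝ) (r : ℝ × ℝ × ℝ) : ℂ := lcRadius r * Complex.exp ((u / 2 : ℝ) * Complex.I)

/-- The second Levi-Civita variable. -/
def lcBeta (u : ℝ) (r : ℝ × ℝ × ℝ) : ℂ :=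
  (r.2.2 - r.2.1 * Complex.I) / 2 * Complex.exp (-((u / 2 : ℝ) * Complex.I))

/-- The position at eccentric longitude `u`. -/
def lcPos (u : ℝ) (r : ℝ × ℝ × ℝ) : ℂ := r.1 * (lcAlpha u r - lcBeta u r) ^ 2

/-- The velocity at eccentric longitude `u`. -/
def lcVel (u : ℝ) (r : ℝ × ℝ × ℝ) : ℂ :=
  Complex.I * (lcAlpha u r + lcBeta u r) / (r.1 * star (lcAlpha u r - lcBeta u r))

/-- The mean longitude at eccentric longitude `u`. -/
def meanLongitude (u : ℝ) (r : ℝ × ℝ × ℝ) : ℝ :=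
  u - lcRadius r / r.1 * (r.2.2 * Real.sin u + r.2.1 * Real.cos u)

/-- The identification of `ℂ` with the Euclidean plane. -/
def toPlane : ℂ ≃ₗᵢ[ℝ] EuclideanSpace ℝ (Fin 2) := Complex.orthonormalBasisOneI.repr

lemma toPlane_apply (z : ℂ) : toPlane z = !₂[z.re, z.im] := by
  ext i
  fin_cases i <;> simp [toPlane, Complex.orthonormalBasisOneI_repr_apply]

/-! ### Moduli and Cartesian components of the Levi-Civita variables. -/

lemma lcRadius_sq {r : ℝ × ℝ × ℝ} (hr : r ∈ shapeSet) :
    lcRadius r ^ 2 = r.1 - (r.2.1 ^ 2 + r.2.2 ^ 2) / 4 :=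
  Real.sq_sqrt (by have := hr.1; have := hr.2; linarith)

lemma lcRadius_pos {r : ℝ × ℝ × ℝ} (hr : r ∈ shapeSet) : 0 < lcRadius r :=
  Real.sqrt_pos.mpr (by have := hr.1; have := hr.2; linarith)

lemma exp_half_mul_I (u : ℝ) : Complex.exp ((u / 2 : ℝ) * Complex.I) =
    ⟨Real.cos (u / 2), Real.sin (u / 2)⟩ := by
  rw [Complex.exp_mul_I, ← Complex.ofReal_cos, ← Complex.ofReal_sin]
  apply Complex.ext <;> simp [-Complex.ofReal_cos, -Complex.ofReal_sin]

lemma exp_neg_half_mul_I (u : ℝ) : Complex.exp (-((u / 2 : ℝ) * Complex.I)) =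
    ⟨Real.cos (u / 2), -Real.sin (u / 2)⟩ := by
  rw [← neg_mul, ← Complex.ofReal_neg, Complex.exp_mul_I, ← Complex.ofReal_cos,
    ← Complex.ofReal_sin]
  apply Complex.ext <;> simp [-Complex.ofReal_cos, -Complex.ofReal_sin]

lemma cos_eq_half (u : ℝ) : Real.cos u = Real.cos (u / 2) ^ 2 - Real.sin (u / 2) ^ 2 := by
  rw [← Real.cos_two_mul']
  ring_nf

lemma sin_eq_half (u : ℝ) : Real.sin u = 2 * Real.sin (u / 2) * Real.cos (u / 2) := by
  rw [← Real.sin_two_mul]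
  ring_nf

lemma lcAlpha_re (u : ℝ) (r : ℝ × ℝ × ℝ) : (lcAlpha u r).re = lcRadius r * Real.cos (u / 2) := by
  rw [lcAlpha, exp_half_mul_I]; simp

lemma lcAlpha_im (u : ℝ) (r : ℝ × ℝ × ℝ) : (lcAlpha u r).im = lcRadius r * Real.sin (u / 2) := by
  rw [lcAlpha, exp_half_mul_I]; simp

lemma lcBeta_eq (u : ℝ) (r : ℝ × ℝ × ℝ) : lcBeta u r =
    ⟨(r.2.2 * Real.cos (u / 2) - r.2.1 * Real.sin (u / 2)) / 2,
      -(r.2.2 * Real.sin (u / 2) + r.2.1 * Real.cos (u / 2)) / 2⟩ := by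
  have h : ((r.2.2 : ℂ) - r.2.1 * Complex.I) / 2 = ⟨r.2.2 / 2, - r.2.1 / 2⟩ := by
    apply Complex.ext <;> simp
  rw [lcBeta, exp_neg_half_mul_I, h]
  apply Complex.ext <;> simp <;> ring

lemma lcBeta_re (u : ℝ) (r : ℝ × ℝ × ℝ) : (lcBeta u r).re =
    (r.2.2 * Real.cos (u / 2) - r.2.1 * Real.sin (u / 2)) / 2 := by
  rw [lcBeta_eq]

lemma lcBeta_im (u : ℝ) (r : ℝ × ℝ × ℝ) : (lcBeta u r).im =
    -(r.2.2 * Real.sin (u / 2) + r.2.1 * Real.cos (u / 2)) / 2 := by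
  rw [lcBeta_eq]

lemma normSq_lcAlpha (u : ℝ) (r : ℝ × ℝ × ℝ) :
    Complex.normSq (lcAlpha u r) = lcRadius r ^ 2 := by
  rw [Complex.normSq_apply, lcAlpha_re, lcAlpha_im]
  linear_combination lcRadius r ^ 2 * Real.sin_sq_add_cos_sq (u / 2)

lemma normSq_lcBeta (u : ℝ) (r : ℝ × ℝ × ℝ) :
    Complex.normSq (lcBeta u r) = (r.2.1 ^ 2 + r.2.2 ^ 2) / 4 := by
  rw [Complex.normSq_apply, lcBeta_re, lcBeta_im]
  linear_combination (r.2.1 ^ 2 + r.2.2 ^ 2) / 4 * Real.sin_sq_add_cos_sq (u / 2)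

/-- Since |σ|² < 2Λ, one has |β|² = |σ|²/4 < Λ - |σ|²/4 = |α|². Geometrically: the orbit never meets
the collision x = 0. -/
lemma lcAlpha_sub_lcBeta_ne_zero (u : ℝ) {r : ℝ × ℝ × ℝ} (hr : r ∈ shapeSet) :
    lcAlpha u r - lcBeta u r ≠ 0 := by
  intro h
  have h1 := congrArg Complex.normSq (sub_eq_zero.mp h)
  rw [normSq_lcAlpha, normSq_lcBeta, lcRadius_sq hr] at h1
  linarith [hr.2]

/-- This quantity is |x|/Λ. It reappears as the denominator of the velocity and as Λ ∂λ/∂u. -/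
lemma normSq_lcAlpha_sub_lcBeta (u : ℝ) {r : ℝ × ℝ × ℝ} (hr : r ∈ shapeSet) :
    Complex.normSq (lcAlpha u r - lcBeta u r) =
      r.1 - lcRadius r * (r.2.2 * Real.cos u - r.2.1 * Real.sin u) := by
  rw [Complex.normSq_apply, Complex.sub_re, Complex.sub_im, lcAlpha_re, lcAlpha_im, lcBeta_re,
    lcBeta_im, cos_eq_half u, sin_eq_half u]
  linear_combination (lcRadius r ^ 2 + (r.2.1 ^ 2 + r.2.2 ^ 2) / 4) *
    Real.sin_sq_add_cos_sq (u / 2) + lcRadius_sq hr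

lemma lcPos_re (u : ℝ) (r : ℝ × ℝ × ℝ) : (lcPos u r).re =
    r.1 * (lcRadius r ^ 2 * Real.cos u - lcRadius r * r.2.2 +
      ((r.2.2 ^ 2 - r.2.1 ^ 2) * Real.cos u - 2 * r.2.2 * r.2.1 * Real.sin u) / 4) := by
  rw [lcPos, sq (lcAlpha u r - lcBeta u r), Complex.re_ofReal_mul, Complex.mul_re,
    Complex.sub_re, Complex.sub_im, lcAlpha_re, lcAlpha_im, lcBeta_re,
    lcBeta_im, cos_eq_half u, sin_eq_half u]
  linear_combination (- r.1 * lcRadius r * r.2.2) * Real.sin_sq_add_cos_sq (u / 2)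

lemma lcPos_im (u : ℝ) (r : ℝ × ℝ × ℝ) : (lcPos u r).im =
    r.1 * (lcRadius r ^ 2 * Real.sin u + lcRadius r * r.2.1 -
      ((r.2.2 ^ 2 - r.2.1 ^ 2) * Real.sin u + 2 * r.2.2 * r.2.1 * Real.cos u) / 4) := by
  rw [lcPos, sq (lcAlpha u r - lcBeta u r), Complex.im_ofReal_mul, Complex.mul_im,
    Complex.sub_re, Complex.sub_im, lcAlpha_re, lcAlpha_im, lcBeta_re,
    lcBeta_im, cos_eq_half u, sin_eq_half u]
  linear_combination (r.1 * lcRadius r * r.2.1) * Real.sin_sq_add_cos_sq (u / 2)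

/-- Multiplying numerator and denominator by c makes the denominator real, so that components can be
read off. -/
lemma lcVel_eq (u : ℝ) {r : ℝ × ℝ × ℝ} (hr : r ∈ shapeSet) : lcVel u r =
    ((r.1 * Complex.normSq (lcAlpha u r - lcBeta u r) : ℝ) : ℂ)⁻¹ *
      (Complex.I * ((lcAlpha u r + lcBeta u r) * (lcAlpha u r - lcBeta u r))) := by
  have h := lcAlpha_sub_lcBeta_ne_zero u hr
  have h2 : (r.1 : ℂ) ≠ 0 := Complex.ofReal_ne_zero.mpr hr.1.ne'
  have h3 : (starRingEnd ℂ) (lcAlpha u r - lcBeta u r) ≠ 0 := star_ne_zero.mpr h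
  rw [lcVel, Complex.ofReal_mul, Complex.normSq_eq_conj_mul_self, ← starRingEnd_apply]
  field_simp

lemma lcVel_re (u : ℝ) {r : ℝ × ℝ × ℝ} (hr : r ∈ shapeSet) : (lcVel u r).re =
    -(lcRadius r ^ 2 * Real.sin u +
      ((r.2.2 ^ 2 - r.2.1 ^ 2) * Real.sin u + 2 * r.2.2 * r.2.1 * Real.cos u) / 4) /
      (r.1 * (r.1 - lcRadius r * (r.2.2 * Real.cos u - r.2.1 * Real.sin u))) := by
  rw [lcVel_eq u hr, ← Complex.ofReal_inv, Complex.re_ofReal_mul, Complex.I_mul_re, Complex.mul_im,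
    Complex.sub_re, Complex.sub_im, Complex.add_re, Complex.add_im,
    normSq_lcAlpha_sub_lcBeta u hr, lcAlpha_re, lcAlpha_im, lcBeta_re, lcBeta_im, div_eq_mul_inv,
    mul_comm (_⁻¹)]
  congr 1
  rw [cos_eq_half u, sin_eq_half u]
  ring_nf

lemma lcVel_im (u : ℝ) {r : ℝ × ℝ × ℝ} (hr : r ∈ shapeSet) : (lcVel u r).im =
    (lcRadius r ^ 2 * Real.cos u -
      ((r.2.2 ^ 2 - r.2.1 ^ 2) * Real.cos u - 2 * r.2.2 * r.2.1 * Real.sin u) / 4) /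
      (r.1 * (r.1 - lcRadius r * (r.2.2 * Real.cos u - r.2.1 * Real.sin u))) := by
  rw [lcVel_eq u hr, ← Complex.ofReal_inv, Complex.im_ofReal_mul, Complex.I_mul_im, Complex.mul_re,
    Complex.sub_re, Complex.sub_im, Complex.add_re, Complex.add_im,
    normSq_lcAlpha_sub_lcBeta u hr, lcAlpha_re, lcAlpha_im, lcBeta_re, lcBeta_im, div_eq_mul_inv,
    mul_comm (_⁻¹)]
  congr 1
  rw [cos_eq_half u, sin_eq_half u]
  ring_nf

/-! ### Agreement of the Levi-Civita form with the definition by orbital elements. -/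

/-- Here β = 0 and |α|² = Λ, and mean and eccentric longitude coincide. -/
lemma poincareMap_circular {u L : ℝ} (hL : 0 < L) :
    poincareMap ((meanLongitude u (L, 0, 0) : ℝ), (L, 0, 0)) =
      (toPlane (lcPos u (L, 0, 0)), toPlane (lcVel u (L, 0, 0))) := by
  have hr : (L, (0 : ℝ), (0 : ℝ)) ∈ shapeSet := ⟨hL, by simpa using hL⟩
  have hm := lcRadius_sq hr
  simp only at hm
  rw [toPlane_apply, toPlane_apply, lcPos_re, lcPos_im, lcVel_re u hr, lcVel_im u hr, hm]
  simp only [poincareMap, circularState, meanLongitude, and_self, if_true, Real.sqrt_sq hL.le]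
  ext i <;> fin_cases i <;> simp <;> field_simp

/-- In polar form σ = ρe^{-ih}, the orbital elements are e = |α|ρ/Λ and √(1 - e²) = (Λ - ρ²/2)/Λ.
What remains is a trigonometric identity obtained by rotating the ellipse through g = -h. -/
lemma poincareMap_elliptic {u L ρ h : ℝ} (hL : 0 < L) (hρ : 0 < ρ) (hρL : ρ ^ 2 < 2 * L)
    (hh : (⟨ρ * Real.cos h, ρ * Real.sin h⟩ : ℂ).arg = h) :
    poincareMap ((meanLongitude u (L, ρ * Real.sin h, ρ * Real.cos h) : ℝ),
        (L, ρ * Real.sin h, ρ * Real.cos h)) =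
      (toPlane (lcPos u (L, ρ * Real.sin h, ρ * Real.cos h)),
        toPlane (lcVel u (L, ρ * Real.sin h, ρ * Real.cos h))) := by
  have hcs := Real.sin_sq_add_cos_sq h
  have hsq : (ρ * Real.sin h) ^ 2 + (ρ * Real.cos h) ^ 2 = ρ ^ 2 := by
    linear_combination ρ ^ 2 * hcs
  have hr : (L, ρ * Real.sin h, ρ * Real.cos h) ∈ shapeSet :=
    ⟨hL, by simp only [hsq]; exact hρL⟩
  have hm := lcRadius_sq hr
  have hmpos := lcRadius_pos hr
  have hne : ¬(ρ * Real.sin h = 0 ∧ ρ * Real.cos h = 0) := by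
    rintro ⟨h1, h2⟩
    rw [h1, h2] at hsq
    nlinarith
  simp only [hsq] at hm
  rw [toPlane_apply, toPlane_apply, lcPos_re, lcPos_im, lcVel_re u hr, lcVel_im u hr]
  simp only [poincareMap, if_neg hne, hh, delaunay, astronomical, meanLongitude, hsq]
  set m := lcRadius (L, ρ * Real.sin h, ρ * Real.cos h)
  have he : √(1 - (L - ρ ^ 2 / 2) ^ 2 / L ^ 2) = m * ρ / L := by
    rw [show 1 - (L - ρ ^ 2 / 2) ^ 2 / L ^ 2 = (m * ρ / L) ^ 2 by
      field_simp
      rw [hm]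
      ring, Real.sqrt_sq (by positivity)]
  have hβ : √(1 - (m * ρ / L) ^ 2) = (L - ρ ^ 2 / 2) / L := by
    rw [show 1 - (m * ρ / L) ^ 2 = ((L - ρ ^ 2 / 2) / L) ^ 2 by
      field_simp
      rw [hm]
      ring, Real.sqrt_sq (div_nonneg (by linarith) hL.le)]
  have he1 : m * ρ / L < 1 := by
    rw [div_lt_one hL]
    apply lt_of_pow_lt_pow_left₀ 2 hL.le
    rw [mul_pow, hm]
    nlinarith
  -- As g = -h, the eccentric anomaly u - g is u + h. Expanding sin(u + h) turns the usual Kepler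
  -- equation into the longitude form.
  have hE : eccentricAnomaly (m * ρ / L)
      (((u - m / L * (ρ * Real.cos h * Real.sin u + ρ * Real.sin h * Real.cos u) : ℝ) :
        Real.Angle) - -(h : Real.Angle)) = ((u + h : ℝ) : Real.Angle) := by
    rw [eccentricAnomaly, show ((u - m / L * (ρ * Real.cos h * Real.sin u +
        ρ * Real.sin h * Real.cos u) : ℝ) : Real.Angle) - -(h : Real.Angle) =
        keplerMap (m * ρ / L) ((u + h : ℝ) : Real.Angle) by
      rw [keplerMap, Real.Angle.sin_coe, Real.sin_add, sub_neg_eq_add, ← Real.Angle.coe_add,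
        ← Real.Angle.coe_sub]
      congr 1
      field_simp
      ring]
    exact Function.leftInverse_invFun
      (keplerMap_bijective (by positivity) he1).injective _
  rw [he, hE, hβ, Real.sqrt_sq hL.le]
  have hD : L * (1 - m * ρ / L * Real.cos (u + h)) =
      L - m * (ρ * Real.cos h * Real.cos u - ρ * Real.sin h * Real.sin u) := by
    rw [Real.cos_add]
    field_simp
  simp only [rotation, Real.Angle.cos_coe, Real.Angle.sin_coe, ← Real.Angle.coe_neg, Real.cos_neg,
    Real.sin_neg, hD]
  set D := L - m * (ρ * Real.cos h * Real.cos u - ρ * Real.sin h * Real.sin u)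
  have hDpos : 0 < D := by
    rw [← hD]
    have h1 : m * ρ / L * Real.cos (u + h) ≤ m * ρ / L :=
      mul_le_of_le_one_right (by positivity) (Real.cos_le_one _)
    exact mul_pos hL (by linarith)
  ext i <;> fin_cases i <;>
    simp only [Fin.zero_eta, Fin.mk_one, Matrix.cons_val_zero, Matrix.cons_val_one,
      Matrix.cons_val_fin_one, hm, Real.cos_add, Real.sin_add]
  · field_simp
    linear_combination 8 * (L - ρ ^ 2 / 4) * Real.cos u * hcs
  · field_simp
    linear_combination 8 * (L - ρ ^ 2 / 4) * Real.sin u * hcs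
  · field_simp
    linear_combination -8 * (L - ρ ^ 2 / 4) * Real.sin u * hcs
  · field_simp
    linear_combination 8 * (L - ρ ^ 2 / 4) * Real.cos u * hcs

/-- In terms of the eccentric longitude the Poincaré map has the Levi-Civita form. -/
lemma poincareMap_meanLongitude (u : ℝ) {r : ℝ × ℝ × ℝ} (hr : r ∈ shapeSet) :
    poincareMap ((meanLongitude u r : ℝ), r) = (toPlane (lcPos u r), toPlane (lcVel u r)) := by
  obtain ⟨L, η, ξ⟩ := r
  obtain ⟨hL, hr⟩ := hr
  simp only at hL hr
  by_cases h0 : η = 0 ∧ ξ = 0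
  · obtain ⟨rfl, rfl⟩ := h0
    exact poincareMap_circular hL
  · have hz : (⟨ξ, η⟩ : ℂ) ≠ 0 := fun h => h0 ⟨congrArg Complex.im h, congrArg Complex.re h⟩
    have h1 : ξ = ‖(⟨ξ, η⟩ : ℂ)‖ * Real.cos (⟨ξ, η⟩ : ℂ).arg :=
      (Complex.norm_mul_cos_arg (⟨ξ, η⟩ : ℂ)).symm
    have h2 : η = ‖(⟨ξ, η⟩ : ℂ)‖ * Real.sin (⟨ξ, η⟩ : ℂ).arg :=
      (Complex.norm_mul_sin_arg (⟨ξ, η⟩ : ℂ)).symm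
    have h3 : ‖(⟨ξ, η⟩ : ℂ)‖ ^ 2 < 2 * L := by
      rw [← Complex.normSq_eq_norm_sq, Complex.normSq_apply]
      linarith
    have h4 := poincareMap_elliptic (u := u) (h := (⟨ξ, η⟩ : ℂ).arg) hL (norm_pos_iff.mpr hz) h3
        (by rw [← h1, ← h2])
    rwa [← h1, ← h2] at h4

/-! ### Sign-invariant products, energy and angular momentum. -/

/-- Together with αβ, this survives the sign change (α, β) ↦ (-α, -β), the ambiguity of the
Levi-Civita square root, and determines u mod 2π. -/
lemma lcAlpha_sq (u : ℝ) (r : ℝ × ℝ × ℝ) :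
    lcAlpha u r ^ 2 = ⟨lcRadius r ^ 2 * Real.cos u, lcRadius r ^ 2 * Real.sin u⟩ := by
  rw [sq]
  apply Complex.ext
  · rw [Complex.mul_re, lcAlpha_re, lcAlpha_im, cos_eq_half u]
    ring
  · rw [Complex.mul_im, lcAlpha_re, lcAlpha_im, sin_eq_half u]
    ring

lemma lcAlpha_mul_lcBeta (u : ℝ) (r : ℝ × ℝ × ℝ) :
    lcAlpha u r * lcBeta u r = ⟨lcRadius r * r.2.2 / 2, -(lcRadius r * r.2.1 / 2)⟩ := by
  have h := Real.sin_sq_add_cos_sq (u / 2)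
  apply Complex.ext
  · rw [Complex.mul_re, lcAlpha_re, lcAlpha_im, lcBeta_re, lcBeta_im]
    linear_combination lcRadius r * r.2.2 / 2 * h
  · rw [Complex.mul_im, lcAlpha_re, lcAlpha_im, lcBeta_re, lcBeta_im]
    linear_combination -lcRadius r * r.2.1 / 2 * h

lemma energy_toPlane (x y : ℂ) : energy (toPlane x, toPlane y) =
    Complex.normSq y / 2 - 1 / ‖x‖ := by
  simp only [energy, LinearIsometryEquiv.norm_map, Complex.normSq_eq_norm_sq]

lemma angularMomentum_toPlane (x y : ℂ) : angularMomentum (toPlane x, toPlane y) =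
    x.re * y.im - x.im * y.re := by
  simp [angularMomentum, toPlane_apply]

/-- The energy of a state in Levi-Civita form. -/
lemma energy_leviCivita {L : ℝ} (hL : 0 < L) {c d : ℂ} (hc : c ≠ 0)
    (h : Complex.normSq c + Complex.normSq d = 2 * L) :
    energy (toPlane (L * c ^ 2), toPlane (Complex.I * d / (L * star c))) = -1 / (2 * L ^ 2) := by
  have hc' : Complex.normSq c ≠ 0 := Complex.normSq_eq_zero.not.mpr hc
  have hs : Complex.normSq (star c) = Complex.normSq c := Complex.normSq_conj c
  rw [energy_toPlane, norm_mul, norm_pow, ← Complex.normSq_eq_norm_sq, Complex.norm_real,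
    Real.norm_of_nonneg hL.le, map_div₀, map_mul, map_mul, Complex.normSq_I,
    Complex.normSq_ofReal, hs, eq_sub_of_add_eq' h]
  field_simp
  ring

/-- The angular momentum of a state in Levi-Civita form. -/
lemma angularMomentum_leviCivita {L : ℝ} (hL : 0 < L) {c d : ℂ} (hc : c ≠ 0) :
    angularMomentum (toPlane (L * c ^ 2), toPlane (Complex.I * d / (L * star c))) =
      c.re * d.re + c.im * d.im := by
  have hc' : star c ≠ 0 := star_ne_zero.mpr hc
  have hL' : (L : ℂ) ≠ 0 := Complex.ofReal_ne_zero.mpr hL.ne'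
  set y := Complex.I * d / (L * star c) with hy
  have h : star c * y * L = Complex.I * d := by
    rw [hy]
    field_simp
  -- The angular momentum is Im(x̄y), and x̄y = i c̄ d, whose imaginary part is Re(c̄ d).
  have h1 : star ((L : ℂ) * c ^ 2) * y = star c * (Complex.I * d) := by
    rw [← h, star_mul', star_pow, Complex.star_def, Complex.conj_ofReal]
    ring
  have h2 := congrArg Complex.im h1
  rw [angularMomentum_toPlane]
  simp only [Complex.mul_im, Complex.star_def, Complex.conj_re, Complex.conj_im, Complex.mul_re,
    Complex.I_re, Complex.I_im] at h2 ⊢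
  linarith

/-- The parallelogram law, with |α|² + |β|² = Λ. -/
lemma normSq_sub_add_normSq_add (u : ℝ) {r : ℝ × ℝ × ℝ} (hr : r ∈ shapeSet) :
    Complex.normSq (lcAlpha u r - lcBeta u r) + Complex.normSq (lcAlpha u r + lcBeta u r) =
      2 * r.1 := by
  have h1 := normSq_lcAlpha u r
  have h2 := normSq_lcBeta u r
  rw [lcRadius_sq hr] at h1
  rw [Complex.normSq_apply] at *
  rw [Complex.normSq_apply]
  simp only [Complex.sub_re, Complex.sub_im, Complex.add_re, Complex.add_im]
  linarith

lemma energy_lc (u : ℝ) {r : ℝ × ℝ × ℝ} (hr : r ∈ shapeSet) :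
    energy (toPlane (lcPos u r), toPlane (lcVel u r)) = -1 / (2 * r.1 ^ 2) :=
  energy_leviCivita hr.1 (lcAlpha_sub_lcBeta_ne_zero u hr) (normSq_sub_add_normSq_add u hr)

/-- Re(c̄ d) = |α|² - |β|², because the cross terms cancel. -/
lemma angularMomentum_lc (u : ℝ) {r : ℝ × ℝ × ℝ} (hr : r ∈ shapeSet) :
    angularMomentum (toPlane (lcPos u r), toPlane (lcVel u r)) =
      r.1 - (r.2.1 ^ 2 + r.2.2 ^ 2) / 2 := by
  rw [lcPos, lcVel, angularMomentum_leviCivita hr.1 (lcAlpha_sub_lcBeta_ne_zero u hr)]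
  have h1 := normSq_lcAlpha u r
  have h2 := normSq_lcBeta u r
  rw [lcRadius_sq hr] at h1
  rw [Complex.normSq_apply] at *
  simp only [Complex.sub_re, Complex.sub_im, Complex.add_re, Complex.add_im]
  linarith

lemma lc_mem_ellipticRegion (u : ℝ) {r : ℝ × ℝ × ℝ} (hr : r ∈ shapeSet) :
    (toPlane (lcPos u r), toPlane (lcVel u r)) ∈ ellipticRegion := by
  have hL := hr.1
  refine ⟨?_, ?_, ?_⟩
  · rw [ne_eq, LinearIsometryEquiv.map_eq_zero_iff, lcPos]
    exact mul_ne_zero (Complex.ofReal_ne_zero.mpr hL.ne')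
      (pow_ne_zero 2 (lcAlpha_sub_lcBeta_ne_zero u hr))
  · rw [energy_lc u hr]
    exact div_neg_of_neg_of_pos (by norm_num) (by positivity)
  · rw [angularMomentum_lc u hr]
    linarith [hr.2]

/-! ### Recovering the Levi-Civita variables from a state. -/

/-- Energy gives Λ and angular momentum then gives |α|. The position fixes c up to sign, and the
velocity fixes d with the same sign; α² and αβ are blind to it. -/
lemma lc_injective {u u' : ℝ} {r r' : ℝ × ℝ × ℝ} (hr : r ∈ shapeSet) (hr' : r' ∈ shapeSet)
    (hx : lcPos u r = lcPos u' r') (hy : lcVel u r = lcVel u' r') :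
    (u : Real.Angle) = u' ∧ r = r' := by
  have hLp := hr.1
  have hLp' := hr'.1
  have hL : r.1 = r'.1 := by
    have h := energy_lc u hr
    rw [hx, hy, energy_lc u' hr'] at h
    rw [div_eq_div_iff (by positivity) (by positivity)] at h
    exact (pow_left_inj₀ hLp.le hLp'.le two_ne_zero).mp (by linarith)
  have hm : lcRadius r = lcRadius r' := by
    have h := angularMomentum_lc u hr
    rw [hx, hy, angularMomentum_lc u' hr', hL] at h
    rw [lcRadius, lcRadius, hL]
    congr 1
    linarith
  have hL0 : (r.1 : ℂ) ≠ 0 := Complex.ofReal_ne_zero.mpr hLp.ne'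
  have hc := lcAlpha_sub_lcBeta_ne_zero u hr
  have hc' := lcAlpha_sub_lcBeta_ne_zero u' hr'
  rw [lcPos, lcPos, ← hL] at hx
  rw [lcVel, lcVel, ← hL] at hy
  have hs := star_ne_zero.mpr hc
  have hs' := star_ne_zero.mpr hc'
  have hprod : lcAlpha u r ^ 2 = lcAlpha u' r' ^ 2 ∧
      lcAlpha u r * lcBeta u r = lcAlpha u' r' * lcBeta u' r' := by
    rw [div_eq_div_iff (mul_ne_zero hL0 hs) (mul_ne_zero hL0 hs')] at hy
    have hy' : (lcAlpha u r + lcBeta u r) * star (lcAlpha u' r' - lcBeta u' r') =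
        (lcAlpha u' r' + lcBeta u' r') * star (lcAlpha u r - lcBeta u r) :=
      mul_left_cancel₀ (mul_ne_zero Complex.I_ne_zero hL0) (by linear_combination hy)
    -- The two sheets of c ↦ c²: on the second, both α and β change sign.
    rcases sq_eq_sq_iff_eq_or_eq_neg.mp (mul_left_cancel₀ hL0 hx) with h | h
    · rw [← h] at hy'
      have h1 := mul_right_cancel₀ hs hy'
      have ha : lcAlpha u r = lcAlpha u' r' := by linear_combination (h + h1) / 2
      have hb : lcBeta u r = lcBeta u' r' := by linear_combination (h1 - h) / 2
      rw [ha, hb]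
      exact ⟨rfl, rfl⟩
    · rw [h, star_neg] at hy'
      have h1 : lcAlpha u r + lcBeta u r = -(lcAlpha u' r' + lcBeta u' r') :=
        mul_right_cancel₀ hs' (by linear_combination hy')
      have ha : lcAlpha u r = -lcAlpha u' r' := by linear_combination (h + h1) / 2
      have hb : lcBeta u r = -lcBeta u' r' := by linear_combination (h1 - h) / 2
      rw [ha, hb]
      constructor <;> ring
  obtain ⟨h1, h2⟩ := hprod
  have hmp := lcRadius_pos hr'
  rw [lcAlpha_sq, lcAlpha_sq, hm] at h1
  rw [lcAlpha_mul_lcBeta, lcAlpha_mul_lcBeta, hm] at h2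
  have e1 := congrArg Complex.re h1
  have e2 := congrArg Complex.im h1
  have e3 := congrArg Complex.re h2
  have e4 := congrArg Complex.im h2
  simp only at e1 e2 e3 e4
  refine ⟨Real.Angle.cos_sin_inj (mul_left_cancel₀ (by positivity) e1)
    (mul_left_cancel₀ (by positivity) e2), Prod.ext hL (Prod.ext ?_ ?_)⟩
  · exact mul_left_cancel₀ hmp.ne' (by linarith)
  · exact mul_left_cancel₀ hmp.ne' (by linarith)

/-- Negative energy defines Λ, any square root of x/Λ serves as c, and y then gives d. For a = (c +
d)/2 and b = (d - c)/2, the energy relation gives |a|² + |b|² = Λ and positive angular momentum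
gives |b| < |a|, which together say |σ|² = 4|b|² < 2Λ. -/
lemma lc_surjective {z : Phase} (hz : z ∈ ellipticRegion) :
    ∃ (u : ℝ) (r : ℝ × ℝ × ℝ), r ∈ shapeSet ∧ (toPlane (lcPos u r), toPlane (lcVel u r)) = z := by
  obtain ⟨x, y⟩ := z
  obtain ⟨x, rfl⟩ := toPlane.surjective x
  obtain ⟨y, rfl⟩ := toPlane.surjective y
  obtain ⟨hx, hE, hM⟩ := hz
  rw [ne_eq, LinearIsometryEquiv.map_eq_zero_iff] at hx
  set E := energy (toPlane x, toPlane y) with hEdef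
  obtain ⟨L, hL, hEL⟩ : ∃ L : ℝ, 0 < L ∧ E = -1 / (2 * L ^ 2) := by
    refine ⟨1 / √(-2 * E), by have : 0 < -2 * E := by linarith
                              positivity, ?_⟩
    rw [div_pow, Real.sq_sqrt (by linarith)]
    field_simp
  have hL0 : (L : ℂ) ≠ 0 := Complex.ofReal_ne_zero.mpr hL.ne'
  obtain ⟨c, hc⟩ := IsAlgClosed.exists_pow_nat_eq (x / L) two_pos
  have hxc : x = L * c ^ 2 := by
    rw [hc]
    field_simp
  have hc0 : c ≠ 0 := by
    rintro rfl
    exact hx (by simp [hxc])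
  have hs0 : star c ≠ 0 := star_ne_zero.mpr hc0
  set d := -Complex.I * L * star c * y with hd
  have hyd : y = Complex.I * d / (L * star c) := by
    rw [hd]
    field_simp
    rw [Complex.I_sq]
    ring
  have hsum : Complex.normSq c + Complex.normSq d = 2 * L := by
    have h1 : ‖x‖ = L * Complex.normSq c := by
      rw [hxc, norm_mul, norm_pow, ← Complex.normSq_eq_norm_sq, Complex.norm_real,
        Real.norm_of_nonneg hL.le]
    have h2 : Complex.normSq d = L ^ 2 * Complex.normSq c * Complex.normSq y := by
      have hs : Complex.normSq (star c) = Complex.normSq c := Complex.normSq_conj c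
      rw [hd, map_mul, map_mul, map_mul, Complex.normSq_neg, Complex.normSq_I,
        Complex.normSq_ofReal, hs]
      ring
    have h3 : 0 < Complex.normSq c := Complex.normSq_pos.mpr hc0
    rw [hEdef, energy_toPlane, h1] at hEL
    rw [h2]
    field_simp at hEL
    linear_combination hEL
  rw [hxc, hyd, angularMomentum_leviCivita hL hc0] at hM
  obtain ⟨a, ha⟩ : ∃ a, a = (c + d) / 2 := ⟨_, rfl⟩
  obtain ⟨b, hb⟩ : ∃ b, b = (d - c) / 2 := ⟨_, rfl⟩
  have hcab : c = a - b := by rw [ha, hb]; ring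
  have hdab : d = a + b := by rw [ha, hb]; ring
  rw [hcab, hdab] at hsum hM
  rw [Complex.normSq_apply, Complex.normSq_apply] at hsum
  simp only [Complex.sub_re, Complex.sub_im, Complex.add_re, Complex.add_im] at hsum hM
  have hab : Complex.normSq a + Complex.normSq b = L := by
    rw [Complex.normSq_apply, Complex.normSq_apply]
    linarith
  have hlt : Complex.normSq b < Complex.normSq a := by
    rw [Complex.normSq_apply, Complex.normSq_apply]
    linarith
  -- With u = 2 arg a, this is the σ that solves β = (σ/2)e^{-iu/2} = b; hence ξ = Re s and η = -Im
  -- s.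
  obtain ⟨s, hs⟩ : ∃ s, s = 2 * b * Complex.exp (a.arg * Complex.I) := ⟨_, rfl⟩
  have hsn : (-s.im) ^ 2 + s.re ^ 2 = 4 * Complex.normSq b := by
    have h1 : Complex.normSq s = 4 * Complex.normSq b := by
      rw [hs, map_mul, map_mul, Complex.normSq_eq_norm_sq (Complex.exp _),
        Complex.norm_exp_ofReal_mul_I, Complex.normSq_ofNat]
      norm_num
    rw [← h1, Complex.normSq_apply]
    ring
  have hα : lcAlpha (2 * a.arg) (L, -s.im, s.re) = a := by
    rw [lcAlpha, lcRadius]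
    simp only [hsn]
    rw [show L - 4 * Complex.normSq b / 4 = ‖a‖ ^ 2 by
      rw [← Complex.normSq_eq_norm_sq]
      linarith, Real.sqrt_sq (norm_nonneg a), mul_div_cancel_left₀ _ (two_ne_zero' ℝ)]
    exact Complex.norm_mul_exp_arg_mul_I a
  have hβ : lcBeta (2 * a.arg) (L, -s.im, s.re) = b := by
    rw [lcBeta]
    simp only
    rw [show ((s.re : ℂ) - ((-s.im : ℝ) : ℂ) * Complex.I) = s by
      apply Complex.ext <;> simp, hs, mul_div_cancel_left₀ _ (two_ne_zero' ℝ), Complex.exp_neg]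
    field_simp
  refine ⟨2 * a.arg, (L, -s.im, s.re), ⟨hL, ?_⟩, ?_⟩
  · simp only [hsn]
    linarith
  · rw [lcPos, lcVel, hα, hβ, ← hcab, ← hdab, ← hxc, ← hyd]

/-! ### Kepler's equation for longitudes, and bijectivity. -/

/-- Positivity of this derivative, from α ≠ β, gives both uniqueness in Kepler's equation and the
analytic dependence of its solution. -/
lemma hasDerivAt_meanLongitude_left (u : ℝ) {r : ℝ × ℝ × ℝ} (hr : r ∈ shapeSet) :
    HasDerivAt (fun s => meanLongitude s r)
      (Complex.normSq (lcAlpha u r - lcBeta u r) / r.1) u := by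
  have h := (hasDerivAt_id u).sub ((((Real.hasDerivAt_sin u).const_mul r.2.2).add
    ((Real.hasDerivAt_cos u).const_mul r.2.1)).const_mul (lcRadius r / r.1))
  refine h.congr_deriv ?_
  have hL := hr.1.ne'
  rw [normSq_lcAlpha_sub_lcBeta u hr]
  field_simp
  ring

lemma meanLongitude_strictMono {r : ℝ × ℝ × ℝ} (hr : r ∈ shapeSet) :
    StrictMono fun u => meanLongitude u r := by
  apply strictMono_of_deriv_pos
  intro u
  rw [(hasDerivAt_meanLongitude_left u hr).deriv]
  exact div_pos (Complex.normSq_pos.mpr (lcAlpha_sub_lcBeta_ne_zero u hr)) hr.1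

/-- The difference λ - u is bounded uniformly in u, so the intermediate value theorem applies on [l
- B, l + B]. -/
lemma meanLongitude_surjective (r : ℝ × ℝ × ℝ) :
    Function.Surjective fun u => meanLongitude u r := by
  intro l
  have hc : Continuous fun u => meanLongitude u r := by
    unfold meanLongitude
    fun_prop
  set B := |lcRadius r / r.1| * (|r.2.2| + |r.2.1|) with hB
  have hb (u : ℝ) : |lcRadius r / r.1 * (r.2.2 * Real.sin u + r.2.1 * Real.cos u)| ≤ B := by
    rw [abs_mul]
    refine mul_le_mul_of_nonneg_left ((abs_add_le _ _).trans (add_le_add ?_ ?_)) (abs_nonneg _)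
    · rw [abs_mul]
      exact mul_le_of_le_one_right (abs_nonneg _) (Real.abs_sin_le_one u)
    · rw [abs_mul]
      exact mul_le_of_le_one_right (abs_nonneg _) (Real.abs_cos_le_one u)
  have h1 := (abs_le.mp (hb (l - B))).1
  have h2 := (abs_le.mp (hb (l + B))).2
  have hB0 : 0 ≤ B := by positivity
  have hm : l ∈ Set.Icc (meanLongitude (l - B) r) (meanLongitude (l + B) r) := by
    unfold meanLongitude
    constructor <;> linarith
  obtain ⟨u, -, hu⟩ := intermediate_value_Icc (by linarith : l - B ≤ l + B) hc.continuousOn hm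
  exact ⟨u, hu⟩

/-- Shows that λ mod 2π depends on u only mod 2π, which is all that `lc_injective` provides. -/
lemma coe_meanLongitude (u : ℝ) (r : ℝ × ℝ × ℝ) :
    (meanLongitude u r : Real.Angle) = (u : Real.Angle) - ((lcRadius r / r.1 *
      (r.2.2 * (u : Real.Angle).sin + r.2.1 * (u : Real.Angle).cos) : ℝ) : Real.Angle) := by
  simp [meanLongitude]

lemma exists_meanLongitude_eq (z : Coord) : ∃ u : ℝ, z = (((meanLongitude u z.2 : ℝ) : Real.Angle), z.2) := by
  obtain ⟨θ, r⟩ := z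
  induction θ using Real.Angle.induction_on with | _ l
  obtain ⟨u, hu⟩ := meanLongitude_surjective r l
  exact ⟨u, by simp only at hu ⊢; rw [hu]⟩

/-- The Poincaré map is a bijection of `Ω` onto `𝓔₊`. -/
lemma poincareMap_bijOn : Set.BijOn poincareMap domain ellipticRegion := by
  refine ⟨fun z hz => ?_, fun z hz z' hz' h => ?_, fun z hz => ?_⟩
  · obtain ⟨u, hu⟩ := exists_meanLongitude_eq z
    rw [hu, poincareMap_meanLongitude u hz]
    exact lc_mem_ellipticRegion u hz
  · obtain ⟨u, hu⟩ := exists_meanLongitude_eq z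
    obtain ⟨u', hu'⟩ := exists_meanLongitude_eq z'
    rw [hu, hu', poincareMap_meanLongitude u hz, poincareMap_meanLongitude u' hz',
      Prod.mk_inj] at h
    obtain ⟨h1, h2⟩ := lc_injective hz hz' (toPlane.injective h.1) (toPlane.injective h.2)
    rw [hu, hu', coe_meanLongitude, coe_meanLongitude, h1, h2]
  · obtain ⟨u, r, hr, h⟩ := lc_surjective hz
    exact ⟨((meanLongitude u r : ℝ), r), hr, (poincareMap_meanLongitude u hr).trans h⟩

/-! ### The symplectic form along curves -/

lemma phaseForm_toPlane (z : Phase) (x₁ y₁ x₂ y₂ : ℂ) :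
    phaseForm z (toPlane x₁, toPlane y₁) (toPlane x₂, toPlane y₂) =
      (x₁ * star y₂ - x₂ * star y₁).re := by
  simp only [phaseForm, toPlane_apply]
  simp
  ring

/-- The form `Re (dx ∧ dȳ)` in the variables `c, d, L` with `x = L c²`, `y = i d / (L c̄)`. -/
lemma leviCivita_form {L : ℝ} (hL : L ≠ 0) {c : ℂ} (hc : c ≠ 0) (d c₁ d₁ c₂ d₂ : ℂ) (l₁ l₂ : ℝ) :
    (((l₁ : ℂ) * c ^ 2 + L * (2 * c * c₁)) *
          star ((Complex.I * d₂ * (L * star c) - Complex.I * d * (l₂ * star c + L * star c₂)) /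
            (L * star c) ^ 2) -
        ((l₂ : ℂ) * c ^ 2 + L * (2 * c * c₂)) *
          star ((Complex.I * d₁ * (L * star c) - Complex.I * d * (l₁ * star c + L * star c₁)) /
            (L * star c) ^ 2)).re =
      2 * (c₁ * star d₂ - c₂ * star d₁).im +
        (l₁ * (c₂ * star d + c * star d₂).im - l₂ * (c₁ * star d + c * star d₁).im) / L := by
  have hL' : (L : ℂ) ≠ 0 := Complex.ofReal_ne_zero.mpr hL
  have hI : star Complex.I = -Complex.I := Complex.conj_I
  have hR (x : ℝ) : star (x : ℂ) = x := Complex.conj_ofReal x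
  -- The terms in l₁l₂ and c₁c₂ are symmetric and drop out under antisymmetrisation. The rest has
  -- the factor -i, and Re(-iw) = Im w.
  have key : ((l₁ : ℂ) * c ^ 2 + L * (2 * c * c₁)) *
          star ((Complex.I * d₂ * (L * star c) - Complex.I * d * (l₂ * star c + L * star c₂)) /
            (L * star c) ^ 2) -
        ((l₂ : ℂ) * c ^ 2 + L * (2 * c * c₂)) *
          star ((Complex.I * d₁ * (L * star c) - Complex.I * d * (l₁ * star c + L * star c₁)) /
            (L * star c) ^ 2) =
      -Complex.I * (2 * (c₁ * star d₂ - c₂ * star d₁) + ((L⁻¹ : ℝ) : ℂ) *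
        (l₁ * (c₂ * star d + c * star d₂) - l₂ * (c₁ * star d + c * star d₁))) := by
    simp only [star_div₀, star_sub, star_add, star_mul', star_pow, star_star, hI, hR,
      Complex.ofReal_inv]
    field_simp
    ring
  rw [key, neg_mul, Complex.neg_re, Complex.I_mul_re, neg_neg, Complex.add_im, Complex.im_ofReal_mul,
    Complex.sub_im (l₁ * _), Complex.im_ofReal_mul, Complex.im_ofReal_mul,
    show (2 : ℂ) = ((2 : ℝ) : ℂ) by norm_num, Complex.im_ofReal_mul]
  ring

/-- The derivative of `lcRadius` in the direction `v`. -/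
def lcRadiusDeriv (r v : ℝ × ℝ × ℝ) : ℝ :=
  (v.1 - (r.2.1 * v.2.1 + r.2.2 * v.2.2) / 2) / (2 * lcRadius r)

/-- The derivative of `lcAlpha` in the direction `(w, v)`. -/
def lcAlphaDeriv (u : ℝ) (r : ℝ × ℝ × ℝ) (w : ℝ) (v : ℝ × ℝ × ℝ) : ℂ :=
  (lcRadiusDeriv r v + lcRadius r * ((w / 2 : ℝ) * Complex.I)) *
    Complex.exp ((u / 2 : ℝ) * Complex.I)

/-- The derivative of `lcBeta` in the direction `(w, v)`. -/
def lcBetaDeriv (u : ℝ) (r : ℝ × ℝ × ℝ) (w : ℝ) (v : ℝ × ℝ × ℝ) : ℂ :=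
  ((v.2.2 - v.2.1 * Complex.I) / 2 - (r.2.2 - r.2.1 * Complex.I) / 2 * ((w / 2 : ℝ) * Complex.I)) *
    Complex.exp (-((u / 2 : ℝ) * Complex.I))

/-- The mixed terms in α and β cancel, leaving 4 Im(α₁ᾱ₂) - 4 Im(β₁β̄₂). The first part is du ∧
d|α|², with |α|² = Λ - |σ|²/4; the second supplies dη ∧ dξ and cancels the |σ|² contribution. -/
lemma im_lcAlphaDeriv_sub_lcBetaDeriv (u : ℝ) {r : ℝ × ℝ × ℝ} (hr : r ∈ shapeSet) (w₁ w₂ : ℝ)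
    (v₁ v₂ : ℝ × ℝ × ℝ) :
    2 * ((lcAlphaDeriv u r w₁ v₁ - lcBetaDeriv u r w₁ v₁) *
          star (lcAlphaDeriv u r w₂ v₂ + lcBetaDeriv u r w₂ v₂) -
        (lcAlphaDeriv u r w₂ v₂ - lcBetaDeriv u r w₂ v₂) *
          star (lcAlphaDeriv u r w₁ v₁ + lcBetaDeriv u r w₁ v₁)).im =
      w₁ * v₂.1 - w₂ * v₁.1 + (v₁.2.1 * v₂.2.2 - v₁.2.2 * v₂.2.1) := by
  have hm := (lcRadius_pos hr).ne'
  have h₁ : 2 * lcRadius r * lcRadiusDeriv r v₁ = v₁.1 - (r.2.1 * v₁.2.1 + r.2.2 * v₁.2.2) / 2 := by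
    rw [lcRadiusDeriv]
    field_simp
  have h₂ : 2 * lcRadius r * lcRadiusDeriv r v₂ = v₂.1 - (r.2.1 * v₂.2.1 + r.2.2 * v₂.2.2) / 2 := by
    rw [lcRadiusDeriv]
    field_simp
  have hcs := Real.sin_sq_add_cos_sq (u / 2)
  have key (a₁ b₁ a₂ b₂ : ℂ) : 2 * ((a₁ - b₁) * star (a₂ + b₂) - (a₂ - b₂) * star (a₁ + b₁)).im =
      4 * (a₁ * star a₂).im - 4 * (b₁ * star b₂).im := by
    simp
    ring
  have hα : 4 * (lcAlphaDeriv u r w₁ v₁ * star (lcAlphaDeriv u r w₂ v₂)).im =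
      2 * lcRadius r * (w₁ * lcRadiusDeriv r v₂ - w₂ * lcRadiusDeriv r v₁) := by
    rw [lcAlphaDeriv, lcAlphaDeriv, exp_half_mul_I]
    simp
    linear_combination 2 * lcRadius r * (w₁ * lcRadiusDeriv r v₂ - w₂ * lcRadiusDeriv r v₁) * hcs
  have hβ : 4 * (lcBetaDeriv u r w₁ v₁ * star (lcBetaDeriv u r w₂ v₂)).im =
      v₁.2.2 * v₂.2.1 - v₁.2.1 * v₂.2.2 + w₂ / 2 * (r.2.2 * v₁.2.2 + r.2.1 * v₁.2.1) -
        w₁ / 2 * (r.2.2 * v₂.2.2 + r.2.1 * v₂.2.1) := by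
    have hσ (x y : ℝ) : ((x : ℂ) - y * Complex.I) / 2 = ⟨x / 2, -y / 2⟩ := by
      apply Complex.ext <;> simp
    rw [lcBetaDeriv, lcBetaDeriv, exp_neg_half_mul_I, hσ, hσ, hσ]
    simp
    linear_combination (v₁.2.2 * v₂.2.1 - v₁.2.1 * v₂.2.2 +
      w₂ / 2 * (r.2.2 * v₁.2.2 + r.2.1 * v₁.2.1) -
        w₁ / 2 * (r.2.2 * v₂.2.2 + r.2.1 * v₂.2.1)) * hcs
  rw [key, hα, hβ]
  linear_combination w₁ * h₂ - w₂ * h₁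

/-- The correction in Kepler's equation is exactly the function Im(c d̄)/Λ that appears in
`leviCivita_form`; this makes λ, rather than u, conjugate to Λ. -/
lemma meanLongitude_eq (u : ℝ) (r : ℝ × ℝ × ℝ) : meanLongitude u r =
    u - ((lcAlpha u r - lcBeta u r) * star (lcAlpha u r + lcBeta u r)).im / r.1 := by
  have h : ((lcAlpha u r - lcBeta u r) * star (lcAlpha u r + lcBeta u r)).im =
      lcRadius r * (r.2.2 * Real.sin u + r.2.1 * Real.cos u) := by
    simp only [Complex.mul_im, Complex.star_def, Complex.conj_re, Complex.conj_im, Complex.add_re,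
      Complex.add_im, Complex.sub_re, Complex.sub_im, lcAlpha_re, lcAlpha_im, lcBeta_re, lcBeta_im,
      cos_eq_half u, sin_eq_half u]
    ring
  rw [h, meanLongitude]
  ring

section Curves

variable {u : ℝ → ℝ} {r : ℝ → ℝ × ℝ × ℝ} {w t : ℝ} {v : ℝ × ℝ × ℝ}

lemma hasDerivAt_lcRadius (hr : HasDerivAt r v t) (ht : r t ∈ shapeSet) :
    HasDerivAt (fun s => lcRadius (r s)) (lcRadiusDeriv (r t) v) t := by
  have h1 : HasDerivAt (fun s => (r s).1) v.1 t := hr.fst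
  have h2 : HasDerivAt (fun s => (r s).2.1) v.2.1 t := hr.snd.fst
  have h3 : HasDerivAt (fun s => (r s).2.2) v.2.2 t := hr.snd.snd
  have h := (h1.sub (((h2.pow 2).add (h3.pow 2)).div_const 4)).sqrt
    (by simpa using (Real.sqrt_pos.mp (lcRadius_pos ht)).ne')
  refine h.congr_deriv ?_
  rw [lcRadiusDeriv]
  simp only [lcRadius, Pi.sub_apply, Pi.add_apply, Pi.pow_apply]
  congr 1
  push_cast
  ring

lemma hasDerivAt_lcAlpha (hu : HasDerivAt u w t) (hr : HasDerivAt r v t) (ht : r t ∈ shapeSet) :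
    HasDerivAt (fun s => lcAlpha (u s) (r s)) (lcAlphaDeriv (u t) (r t) w v) t := by
  have h := (hasDerivAt_lcRadius hr ht).ofReal_comp.mul
    (((hu.div_const 2).ofReal_comp.mul_const Complex.I).cexp)
  refine h.congr_deriv ?_
  rw [lcAlphaDeriv]
  ring

lemma hasDerivAt_lcBeta (hu : HasDerivAt u w t) (hr : HasDerivAt r v t) :
    HasDerivAt (fun s => lcBeta (u s) (r s)) (lcBetaDeriv (u t) (r t) w v) t := by
  have h2 : HasDerivAt (fun s => (r s).2.1) v.2.1 t := hr.snd.fst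
  have h3 : HasDerivAt (fun s => (r s).2.2) v.2.2 t := hr.snd.snd
  have h := ((h3.ofReal_comp.sub (h2.ofReal_comp.mul_const Complex.I)).div_const 2).mul
    (((hu.div_const 2).ofReal_comp.mul_const Complex.I).neg.cexp)
  refine h.congr_deriv ?_
  rw [lcBetaDeriv]
  simp only [Pi.sub_apply, Pi.neg_apply]
  ring

/-- The derivative of `lcAlpha - lcBeta` in the direction `(w, v)`. -/
def lcSubDeriv (u : ℝ) (r : ℝ × ℝ × ℝ) (w : ℝ) (v : ℝ × ℝ × ℝ) : ℂ :=
  lcAlphaDeriv u r w v - lcBetaDeriv u r w v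

/-- The derivative of `lcAlpha + lcBeta` in the direction `(w, v)`. -/
def lcAddDeriv (u : ℝ) (r : ℝ × ℝ × ℝ) (w : ℝ) (v : ℝ × ℝ × ℝ) : ℂ :=
  lcAlphaDeriv u r w v + lcBetaDeriv u r w v

/-- The derivative of `lcPos` in the direction `(w, v)`. -/
def lcPosDeriv (u : ℝ) (r : ℝ × ℝ × ℝ) (w : ℝ) (v : ℝ × ℝ × ℝ) : ℂ :=
  v.1 * (lcAlpha u r - lcBeta u r) ^ 2 +
    r.1 * (2 * (lcAlpha u r - lcBeta u r) * lcSubDeriv u r w v)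

/-- The derivative of `lcVel` in the direction `(w, v)`. -/
def lcVelDeriv (u : ℝ) (r : ℝ × ℝ × ℝ) (w : ℝ) (v : ℝ × ℝ × ℝ) : ℂ :=
  (Complex.I * lcAddDeriv u r w v * (r.1 * star (lcAlpha u r - lcBeta u r)) -
    Complex.I * (lcAlpha u r + lcBeta u r) *
      (v.1 * star (lcAlpha u r - lcBeta u r) + r.1 * star (lcSubDeriv u r w v))) /
    (r.1 * star (lcAlpha u r - lcBeta u r)) ^ 2

/-- The derivative of `meanLongitude` in the direction `(w, v)`. -/
def meanLongitudeDeriv (u : ℝ) (r : ℝ × ℝ × ℝ) (w : ℝ) (v : ℝ × ℝ × ℝ) : ℝ :=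
  w - ((lcSubDeriv u r w v * star (lcAlpha u r + lcBeta u r) +
    (lcAlpha u r - lcBeta u r) * star (lcAddDeriv u r w v)).im * r.1 -
      ((lcAlpha u r - lcBeta u r) * star (lcAlpha u r + lcBeta u r)).im * v.1) / r.1 ^ 2

lemma hasDerivAt_lcPos (hu : HasDerivAt u w t) (hr : HasDerivAt r v t) (ht : r t ∈ shapeSet) :
    HasDerivAt (fun s => lcPos (u s) (r s)) (lcPosDeriv (u t) (r t) w v) t := by
  have h1 : HasDerivAt (fun s => (r s).1) v.1 t := hr.fst
  have h := h1.ofReal_comp.mul (((hasDerivAt_lcAlpha hu hr ht).sub (hasDerivAt_lcBeta hu hr)).pow 2)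
  refine h.congr_deriv ?_
  simp [lcPosDeriv, lcSubDeriv]

lemma hasDerivAt_lcVel (hu : HasDerivAt u w t) (hr : HasDerivAt r v t) (ht : r t ∈ shapeSet) :
    HasDerivAt (fun s => lcVel (u s) (r s)) (lcVelDeriv (u t) (r t) w v) t := by
  have h1 : HasDerivAt (fun s => (r s).1) v.1 t := hr.fst
  have hα := hasDerivAt_lcAlpha hu hr ht
  have hβ := hasDerivAt_lcBeta hu hr
  exact ((hα.add hβ).const_mul Complex.I).div (h1.ofReal_comp.mul (hα.sub hβ).star)
    (mul_ne_zero (Complex.ofReal_ne_zero.mpr ht.1.ne')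
      (star_ne_zero.mpr (lcAlpha_sub_lcBeta_ne_zero (u t) ht)))

lemma hasDerivAt_meanLongitude (hu : HasDerivAt u w t) (hr : HasDerivAt r v t)
    (ht : r t ∈ shapeSet) :
    HasDerivAt (fun s => meanLongitude (u s) (r s)) (meanLongitudeDeriv (u t) (r t) w v) t := by
  have h1 : HasDerivAt (fun s => (r s).1) v.1 t := hr.fst
  have hα := hasDerivAt_lcAlpha hu hr ht
  have hβ := hasDerivAt_lcBeta hu hr
  have h2 := Complex.imCLM.hasFDerivAt.comp_hasDerivAt t ((hα.sub hβ).mul (hα.add hβ).star)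
  simp only [meanLongitude_eq]
  exact hu.sub (h2.div h1 ht.1.ne')

end Curves

/-- The Levi-Civita form of the Poincaré map is symplectic. -/
lemma lc_symplectic (z : Phase) (u : ℝ) {r : ℝ × ℝ × ℝ} (hr : r ∈ shapeSet) (w₁ w₂ : ℝ)
    (v₁ v₂ : ℝ × ℝ × ℝ) :
    phaseForm z (toPlane (lcPosDeriv u r w₁ v₁), toPlane (lcVelDeriv u r w₁ v₁))
        (toPlane (lcPosDeriv u r w₂ v₂), toPlane (lcVelDeriv u r w₂ v₂)) =
      meanLongitudeDeriv u r w₁ v₁ * v₂.1 - v₁.1 * meanLongitudeDeriv u r w₂ v₂ +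
        (v₁.2.1 * v₂.2.2 - v₁.2.2 * v₂.2.1) := by
  have hL := hr.1.ne'
  rw [phaseForm_toPlane, lcPosDeriv, lcPosDeriv, lcVelDeriv, lcVelDeriv,
    leviCivita_form hL (lcAlpha_sub_lcBeta_ne_zero u hr), meanLongitudeDeriv, meanLongitudeDeriv]
  -- This evaluates the 2 Im(dc ∧ dd̄) part; the other terms are the difference between dλ ∧ dΛ and
  -- du ∧ dΛ, where the Im(c d̄) dΛ/Λ² part of dλ contributes nothing.
  have h := im_lcAlphaDeriv_sub_lcBetaDeriv u hr w₁ w₂ v₁ v₂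
  rw [← lcSubDeriv, ← lcSubDeriv, ← lcAddDeriv, ← lcAddDeriv] at h
  rw [h]
  field_simp
  ring

/-! ### Analyticity of the lifted Poincaré map -/

/-- An analytic map with injective derivative between spaces of equal finite dimension has a local
right inverse that is analytic. -/
lemma exists_contDiffAt_rightInverse {E F : Type*} [NormedAddCommGroup E] [NormedSpace ℝ E]
    [FiniteDimensional ℝ E] [NormedAddCommGroup F] [NormedSpace ℝ F] [FiniteDimensional ℝ F]
    (hEF : Module.finrank ℝ E = Module.finrank ℝ F) {f : E → F} {a : E} (hf : ContDiffAt ℝ ω f a)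
    (hinj : ∀ v, fderiv ℝ f a v = 0 → v = 0) :
    ∃ g : F → E, ContDiffAt ℝ ω g (f a) ∧ g (f a) = a ∧ ∀ᶠ y in nhds (f a), f (g y) = y := by
  have : CompleteSpace E := FiniteDimensional.complete ℝ E
  have hn : (ω : WithTop ℕ∞) ≠ 0 := by simp
  let e : E ≃L[ℝ] F := (LinearEquiv.ofInjectiveOfFinrankEq (fderiv ℝ f a).toLinearMap
    ((injective_iff_map_eq_zero _).mpr hinj) hEF).toContinuousLinearEquiv
  have he : HasFDerivAt f (e : E →L[ℝ] F) a := by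
    convert! (hf.differentiableAt hn).hasFDerivAt using 1
  exact ⟨hf.localInverse he hn, hf.to_localInverse he hn, hf.localInverse_apply_image he hn,
    (hf.hasStrictFDerivAt' he hn).eventually_right_inverse⟩

lemma isOpen_shapeSet : IsOpen shapeSet :=
  (isOpen_lt (f := fun _ : ℝ × ℝ × ℝ => (0 : ℝ)) (g := fun r => r.1) (by fun_prop)
    (by fun_prop)).inter (isOpen_lt (f := fun r : ℝ × ℝ × ℝ => r.2.1 ^ 2 + r.2.2 ^ 2)
      (g := fun r => 2 * r.1) (by fun_prop) (by fun_prop))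

lemma eventually_mem_shapeSet {p : ℝ × ℝ × ℝ × ℝ} (hp : p.2 ∈ shapeSet) :
    ∀ᶠ q in nhds p, q.2 ∈ shapeSet :=
  continuous_snd.continuousAt.preimage_mem_nhds (isOpen_shapeSet.mem_nhds hp)

lemma contDiffAt_lcRadius {r : ℝ × ℝ × ℝ} (hr : r ∈ shapeSet) : ContDiffAt ℝ ω lcRadius r := by
  refine ContDiffAt.sqrt (by fun_prop) (Real.sqrt_pos.mp (lcRadius_pos hr)).ne'

lemma contDiffAt_lcAlpha {p : ℝ × ℝ × ℝ × ℝ} (hp : p.2 ∈ shapeSet)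
    {f : ℝ × ℝ × ℝ × ℝ → ℝ} (hf : ContDiffAt ℝ ω f p) :
    ContDiffAt ℝ ω (fun q : ℝ × ℝ × ℝ × ℝ => lcAlpha (f q) q.2) p := by
  have h1 : ContDiffAt ℝ ω (fun q : ℝ × ℝ × ℝ × ℝ => (lcRadius q.2 : ℂ)) p :=
    Complex.ofRealCLM.contDiff.contDiffAt.comp p
      ((contDiffAt_lcRadius hp).comp p contDiffAt_snd)
  have h2 : ContDiffAt ℝ ω (fun q : ℝ × ℝ × ℝ × ℝ => ((f q / 2 : ℝ) : ℂ)) p :=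
    Complex.ofRealCLM.contDiff.contDiffAt.comp p (hf.div_const 2)
  exact h1.mul (h2.mul contDiffAt_const).cexp

lemma contDiffAt_lcBeta {p : ℝ × ℝ × ℝ × ℝ} {f : ℝ × ℝ × ℝ × ℝ → ℝ}
    (hf : ContDiffAt ℝ ω f p) :
    ContDiffAt ℝ ω (fun q : ℝ × ℝ × ℝ × ℝ => lcBeta (f q) q.2) p := by
  have h1 : ContDiffAt ℝ ω (fun q : ℝ × ℝ × ℝ × ℝ => (q.2.2.2 : ℂ)) p :=
    Complex.ofRealCLM.contDiff.contDiffAt.comp p (by fun_prop)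
  have h2 : ContDiffAt ℝ ω (fun q : ℝ × ℝ × ℝ × ℝ => (q.2.2.1 : ℂ)) p :=
    Complex.ofRealCLM.contDiff.contDiffAt.comp p (by fun_prop)
  have h3 : ContDiffAt ℝ ω (fun q : ℝ × ℝ × ℝ × ℝ => ((f q / 2 : ℝ) : ℂ)) p :=
    Complex.ofRealCLM.contDiff.contDiffAt.comp p (hf.div_const 2)
  exact ((h1.sub (h2.mul contDiffAt_const)).div_const 2).mul (h3.mul contDiffAt_const).neg.cexp

lemma contDiffAt_lcPos {p : ℝ × ℝ × ℝ × ℝ} (hp : p.2 ∈ shapeSet)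
    {f : ℝ × ℝ × ℝ × ℝ → ℝ} (hf : ContDiffAt ℝ ω f p) :
    ContDiffAt ℝ ω (fun q : ℝ × ℝ × ℝ × ℝ => lcPos (f q) q.2) p := by
  have h1 : ContDiffAt ℝ ω (fun q : ℝ × ℝ × ℝ × ℝ => (q.2.1 : ℂ)) p :=
    Complex.ofRealCLM.contDiff.contDiffAt.comp p (by fun_prop)
  exact h1.mul (((contDiffAt_lcAlpha hp hf).sub (contDiffAt_lcBeta hf)).pow 2)

lemma contDiffAt_lcVel {p : ℝ × ℝ × ℝ × ℝ} (hp : p.2 ∈ shapeSet)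
    {f : ℝ × ℝ × ℝ × ℝ → ℝ} (hf : ContDiffAt ℝ ω f p) :
    ContDiffAt ℝ ω (fun q : ℝ × ℝ × ℝ × ℝ => lcVel (f q) q.2) p := by
  have h1 : ContDiffAt ℝ ω (fun q : ℝ × ℝ × ℝ × ℝ => (q.2.1 : ℂ)) p :=
    Complex.ofRealCLM.contDiff.contDiffAt.comp p (by fun_prop)
  have hα := contDiffAt_lcAlpha hp hf
  have hβ := contDiffAt_lcBeta hf
  have h2 : ContDiffAt ℝ ω (fun q : ℝ × ℝ × ℝ × ℝ => star (lcAlpha (f q) q.2 - lcBeta (f q) q.2)) p :=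
    Complex.conjCLE.contDiff.contDiffAt.comp p (hα.sub hβ)
  simp only [lcVel, div_eq_mul_inv]
  exact (contDiffAt_const.mul (hα.add hβ)).mul ((h1.mul h2).inv <|
    mul_ne_zero (Complex.ofReal_ne_zero.mpr hp.1.ne')
      (star_ne_zero.mpr (lcAlpha_sub_lcBeta_ne_zero (f p) hp)))

lemma contDiffAt_toPlane_comp {p : ℝ × ℝ × ℝ × ℝ} {f : ℝ × ℝ × ℝ × ℝ → ℂ}
    (hf : ContDiffAt ℝ ω f p) : ContDiffAt ℝ ω (fun q => toPlane (f q)) p :=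
  toPlane.contDiff.contDiffAt.comp p hf

/-- The change of variables from eccentric to mean longitude. -/
def toMeanLongitude (p : ℝ × ℝ × ℝ × ℝ) : ℝ × ℝ × ℝ × ℝ := (meanLongitude p.1 p.2, p.2)

lemma contDiffAt_toMeanLongitude {p : ℝ × ℝ × ℝ × ℝ} (hp : p.2 ∈ shapeSet) :
    ContDiffAt ℝ ω toMeanLongitude p := by
  have h1 : ContDiffAt ℝ ω (fun q : ℝ × ℝ × ℝ × ℝ => lcRadius q.2) p :=
    (contDiffAt_lcRadius hp).comp p contDiffAt_snd
  refine ContDiffAt.prodMk (contDiffAt_fst.sub ((h1.div (by fun_prop) hp.1.ne').mul ?_))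
    contDiffAt_snd
  fun_prop

/-- The Jacobian is triangular: the identity on (Λ, η, ξ), and ∂λ/∂u > 0 on the remaining line. -/
lemma fderiv_toMeanLongitude_injective {p : ℝ × ℝ × ℝ × ℝ} (hp : p.2 ∈ shapeSet)
    (v : ℝ × ℝ × ℝ × ℝ) (hv : fderiv ℝ toMeanLongitude p v = 0) : v = 0 := by
  have hd : HasFDerivAt toMeanLongitude (fderiv ℝ toMeanLongitude p) p :=
    ((contDiffAt_toMeanLongitude hp).differentiableAt (by simp)).hasFDerivAt
  obtain ⟨w, v⟩ := v
  have h1 : v = 0 := by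
    have h2 := congrArg (fun A : (ℝ × ℝ × ℝ × ℝ) →L[ℝ] ℝ × ℝ × ℝ => A (w, v))
      (hd.snd.unique hasFDerivAt_snd)
    simpa [hv, eq_comm] using h2
  subst h1
  have hline : HasDerivAt (fun s : ℝ => (s, p.2)) ((1 : ℝ), (0 : ℝ × ℝ × ℝ)) p.1 :=
    (hasDerivAt_id p.1).prodMk (hasDerivAt_const _ _)
  have h3 := hd.fst.comp_hasDerivAt p.1 hline
  have h4 := h3.unique (hasDerivAt_meanLongitude_left p.1 hp)
  have h5 : (fderiv ℝ toMeanLongitude p ((1 : ℝ), (0 : ℝ × ℝ × ℝ))).1 ≠ 0 := by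
    refine ne_of_eq_of_ne h4 (div_pos (Complex.normSq_pos.mpr ?_) hp.1).ne'
    exact lcAlpha_sub_lcBeta_ne_zero p.1 hp
  have h6 : ((w, 0) : ℝ × ℝ × ℝ × ℝ) = w • ((1 : ℝ), (0 : ℝ × ℝ × ℝ)) := by simp
  rw [h6, map_smul] at hv
  have h7 : w * (fderiv ℝ toMeanLongitude p ((1 : ℝ), (0 : ℝ × ℝ × ℝ))).1 = 0 :=
    congrArg Prod.fst hv
  rw [(mul_eq_zero.mp h7).resolve_right h5]
  rfl

/-- The eccentric longitude as a function of the mean longitude. -/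
def eccentricLongitude (p : ℝ × ℝ × ℝ × ℝ) : ℝ :=
  Function.invFun (fun u => meanLongitude u p.2) p.1

lemma meanLongitude_eccentricLongitude (p : ℝ × ℝ × ℝ × ℝ) :
    meanLongitude (eccentricLongitude p) p.2 = p.1 :=
  Function.rightInverse_invFun (meanLongitude_surjective p.2) p.1

/-- The inverse function theorem yields an analytic local solution of Kepler's equation; strict
monotonicity in u identifies it with the chosen global one. -/
lemma contDiffAt_eccentricLongitude {p : ℝ × ℝ × ℝ × ℝ} (hp : p.2 ∈ shapeSet) :
    ContDiffAt ℝ ω eccentricLongitude p := by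
  have hpu : toMeanLongitude (eccentricLongitude p, p.2) = p :=
    Prod.ext (meanLongitude_eccentricLongitude p) rfl
  obtain ⟨g, hg, -, hgr⟩ := exists_contDiffAt_rightInverse rfl
    (contDiffAt_toMeanLongitude (p := (eccentricLongitude p, p.2)) hp)
    (fderiv_toMeanLongitude_injective hp)
  rw [hpu] at hg hgr
  refine hg.fst.congr_of_eventuallyEq ?_
  filter_upwards [hgr, eventually_mem_shapeSet hp] with q hq hqs
  obtain ⟨h1, h2⟩ := Prod.mk_inj.mp (show (meanLongitude (g q).1 (g q).2, (g q).2) = (q.1, q.2)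
    from hq)
  rw [h2] at h1
  exact (meanLongitude_strictMono hqs).injective
    ((meanLongitude_eccentricLongitude q).trans h1.symm)

/-! ### The lift of the Poincaré map to the universal cover. -/

/-- The universal covering map `ℝ × ℝ³ → 𝕋 × ℝ³`. -/
def covering (p : ℝ × ℝ × ℝ × ℝ) : Coord := ((p.1 : Real.Angle), p.2)

lemma poincareMap_covering {p : ℝ × ℝ × ℝ × ℝ} (hp : p.2 ∈ shapeSet) :
    poincareMap (covering p) =
      (toPlane (lcPos (eccentricLongitude p) p.2), toPlane (lcVel (eccentricLongitude p) p.2)) := by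
  rw [← poincareMap_meanLongitude _ hp, meanLongitude_eccentricLongitude, covering]

lemma contDiffAt_poincareMap_covering {p : ℝ × ℝ × ℝ × ℝ} (hp : p.2 ∈ shapeSet) :
    ContDiffAt ℝ ω (poincareMap ∘ covering) p := by
  have h1 : ContDiffAt ℝ ω
      (fun q : ℝ × ℝ × ℝ × ℝ => toPlane (lcPos (eccentricLongitude q) q.2)) p :=
    contDiffAt_toPlane_comp (contDiffAt_lcPos hp (contDiffAt_eccentricLongitude hp))
  have h2 : ContDiffAt ℝ ω
      (fun q : ℝ × ℝ × ℝ × ℝ => toPlane (lcVel (eccentricLongitude q) q.2)) p :=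
    contDiffAt_toPlane_comp (contDiffAt_lcVel hp (contDiffAt_eccentricLongitude hp))
  refine ContDiffAt.congr_of_eventuallyEq (h1.prodMk h2) ?_
  exact (eventually_mem_shapeSet hp).mono fun q hq => poincareMap_covering hq

/-- The number w is the rate of change of the eccentric longitude along the line p + sv.
Differentiating Kepler's equation along that line relates it to dλ(v), so u never has to be
differentiated explicitly. -/
lemma exists_fderiv_poincareMap_covering {p : ℝ × ℝ × ℝ × ℝ} (hp : p.2 ∈ shapeSet)
    (v : ℝ × ℝ × ℝ × ℝ) : ∃ w : ℝ, meanLongitudeDeriv (eccentricLongitude p) p.2 w v.2 = v.1 ∧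
      fderiv ℝ (poincareMap ∘ covering) p v =
        (toPlane (lcPosDeriv (eccentricLongitude p) p.2 w v.2),
          toPlane (lcVelDeriv (eccentricLongitude p) p.2 w v.2)) := by
  have hline : HasDerivAt (fun s : ℝ => p + s • v) v 0 := by
    simpa using ((hasDerivAt_id (0 : ℝ)).smul_const v).const_add p
  have hp0 : p + (0 : ℝ) • v = p := by simp
  have hr : HasDerivAt (fun s : ℝ => (p + s • v).2) v.2 0 := hline.snd
  have hu : HasDerivAt (fun s : ℝ => eccentricLongitude (p + s • v))
      (fderiv ℝ eccentricLongitude p v) 0 := by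
    refine HasFDerivAt.comp_hasDerivAt (l := eccentricLongitude) 0 ?_ hline
    rw [hp0]
    exact ((contDiffAt_eccentricLongitude hp).differentiableAt (by simp)).hasFDerivAt
  have hr0 : (p + (0 : ℝ) • v).2 ∈ shapeSet := by rwa [hp0]
  refine ⟨fderiv ℝ eccentricLongitude p v, ?_, ?_⟩
  · have h := hasDerivAt_meanLongitude hu hr hr0
    simp only [meanLongitude_eccentricLongitude, hp0] at h
    exact h.unique hline.fst
  · have h1 := hasDerivAt_lcPos hu hr hr0
    have h2 := hasDerivAt_lcVel hu hr hr0
    rw [hp0] at h1 h2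
    have h3 := (toPlane.toContinuousLinearEquiv.hasFDerivAt.comp_hasDerivAt 0 h1).prodMk
      (toPlane.toContinuousLinearEquiv.hasFDerivAt.comp_hasDerivAt 0 h2)
    have h4 : HasDerivAt (fun s : ℝ => (poincareMap ∘ covering) (p + s • v))
        (fderiv ℝ (poincareMap ∘ covering) p v) 0 := by
      refine HasFDerivAt.comp_hasDerivAt (l := poincareMap ∘ covering) 0 ?_ hline
      rw [hp0]
      exact ((contDiffAt_poincareMap_covering hp).differentiableAt (by simp)).hasFDerivAt
    refine h4.unique (h3.congr_of_eventuallyEq ?_)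
    have hc : ContinuousAt (fun s : ℝ => p + s • v) 0 := hline.continuousAt
    filter_upwards [hc.eventually (eventually_mem_shapeSet hr0)] with s hs
    exact poincareMap_covering hs

/-- The lifted Poincaré map is symplectic. -/
lemma fderiv_poincareMap_covering_symplectic (z : Phase) {p : ℝ × ℝ × ℝ × ℝ} (hp : p.2 ∈ shapeSet)
    (v₁ v₂ : ℝ × ℝ × ℝ × ℝ) :
    phaseForm z (fderiv ℝ (poincareMap ∘ covering) p v₁) (fderiv ℝ (poincareMap ∘ covering) p v₂) =
      (v₁.1 * v₂.2.1 - v₁.2.1 * v₂.1) + (v₁.2.2.1 * v₂.2.2.2 - v₁.2.2.2 * v₂.2.2.1) := by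
  obtain ⟨w₁, h₁, e₁⟩ := exists_fderiv_poincareMap_covering hp v₁
  obtain ⟨w₂, h₂, e₂⟩ := exists_fderiv_poincareMap_covering hp v₂
  rw [e₁, e₂, lc_symplectic z _ hp, h₁, h₂]

/-- A kernel vector pairs to zero with every vector under the pulled-back form, which is the
nondegenerate standard form; the basis vectors detect its components. -/
lemma fderiv_poincareMap_covering_injective {p : ℝ × ℝ × ℝ × ℝ} (hp : p.2 ∈ shapeSet)
    (v : ℝ × ℝ × ℝ × ℝ) (hv : fderiv ℝ (poincareMap ∘ covering) p v = 0) : v = 0 := by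
  have h (w : ℝ × ℝ × ℝ × ℝ) :
      (v.1 * w.2.1 - v.2.1 * w.1) + (v.2.2.1 * w.2.2.2 - v.2.2.2 * w.2.2.1) = 0 := by
    rw [← fderiv_poincareMap_covering_symplectic 0 hp v w, hv]
    simp [phaseForm]
  obtain ⟨a, b, c, d⟩ := v
  have h1 := h (0, 1, 0, 0)
  have h2 := h (1, 0, 0, 0)
  have h3 := h (0, 0, 0, 1)
  have h4 := h (0, 0, 1, 0)
  simp at h1 h2 h3 h4
  simp [h1, h2, h3, h4]

/-! ### The Poincaré map on the manifold `𝕋 × ℝ³` -/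

/-- A map into an open subset is `C^n` if its composition with the inclusion is. -/
lemma contMDiffAt_of_subtypeVal_comp {𝕜 : Type*} [NontriviallyNormedField 𝕜]
    {E : Type*} [NormedAddCommGroup E] [NormedSpace 𝕜 E] {H : Type*} [TopologicalSpace H]
    {I : ModelWithCorners 𝕜 E H} {M : Type*} [TopologicalSpace M] [ChartedSpace H M]
    {E' : Type*} [NormedAddCommGroup E'] [NormedSpace 𝕜 E'] {H' : Type*} [TopologicalSpace H']
    {I' : ModelWithCorners 𝕜 E' H'} {M' : Type*} [TopologicalSpace M'] [ChartedSpace H' M']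
    {n : WithTop ℕ∞} {U : TopologicalSpace.Opens M'} {f : M → U} {x : M}
    (h : ContMDiffAt I I' n (Subtype.val ∘ f) x) : ContMDiffAt I I' n f x :=
  (ChartedSpace.liftPropWithinAt_subtypeVal_comp_iff ..).mp h

lemma contMDiff_angleCoe : ContMDiff 𝓘(ℝ, ℝ) 𝓘(ℝ, ℝ) ω (fun s : ℝ => (s : Real.Angle)) := by
  intro t
  refine ⟨Real.Angle.continuous_coe.continuousAt.continuousWithinAt, ?_⟩
  obtain ⟨c, hc⟩ := angleCoe_symm_coe_eventuallyEq _ t (mem_angleCoe_target (t : Real.Angle))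
  have h : ContDiffAt ℝ ω (fun s : ℝ => s + c) t := contDiffAt_id.add contDiffAt_const
  exact (h.congr_of_eventuallyEq hc).contDiffWithinAt

lemma contMDiff_covering : ContMDiff 𝓘(ℝ, ℝ × ℝ × ℝ × ℝ) coordModel ω covering :=
  (contMDiff_angleCoe.comp contDiff_fst.contMDiff).prodMk contDiff_snd.contMDiff

/-- The covering map has local sections that are analytic. -/
lemma exists_covering_section (z : Coord) : ∃ s : Coord → ℝ × ℝ × ℝ × ℝ,
    ContMDiffAt coordModel 𝓘(ℝ, ℝ × ℝ × ℝ × ℝ) ω s z ∧ (∀ z', (s z').2 = z'.2) ∧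
      ∀ᶠ z' in nhds z, covering (s z') = z' := by
  have h1 : ContMDiffAt 𝓘(ℝ, ℝ) 𝓘(ℝ, ℝ) ω (chartAt ℝ z.1) z.1 :=
    contMDiffAt_of_mem_maximalAtlas (IsManifold.chart_mem_maximalAtlas z.1) (mem_chart_source ℝ z.1)
  refine ⟨fun z' => (chartAt ℝ z.1 z'.1, z'.2),
    (h1.comp z contMDiffAt_fst).prodMk_space contMDiffAt_snd, fun _ => rfl, ?_⟩
  have h2 : ∀ᶠ z' : Coord in nhds z, z'.1 ∈ (chartAt ℝ z.1).source :=
    continuous_fst.continuousAt.preimage_mem_nhds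
      ((chartAt ℝ z.1).open_source.mem_nhds (mem_chart_source ℝ z.1))
  filter_upwards [h2] with z' hz'
  exact Prod.ext ((chartAt ℝ z.1).left_inv hz') rfl

lemma exists_covering_eq (z : Coord) : ∃ p, covering p = z := by
  obtain ⟨s, -, -, h⟩ := exists_covering_section z
  exact ⟨s z, h.self_of_nhds⟩

/-- Near z the map factors through an analytic section of the covering followed by the analytic
lift. -/
lemma contMDiffAt_poincareMap {z : Coord} (hz : z ∈ domain) :
    ContMDiffAt coordModel 𝓘(ℝ, Phase) ω poincareMap z := by
  obtain ⟨s, hs, h2, h⟩ := exists_covering_section z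
  have h3 : (s z).2 ∈ shapeSet := by
    rw [h2]
    exact hz
  have h4 := (contDiffAt_poincareMap_covering h3).contMDiffAt.comp z hs
  refine h4.congr_of_eventuallyEq (h.mono fun z' hz' => ?_)
  simp only [Function.comp_apply, hz']

/-- In the angular coordinate the covering has derivative the identity, so the chain rule carries
symplecticity from the lift to 𝕋 × ℝ³. -/
lemma mfderiv_poincareMap {p : ℝ × ℝ × ℝ × ℝ} (hp : p.2 ∈ shapeSet) (v : ℝ × ℝ × ℝ × ℝ) :
    mfderiv coordModel 𝓘(ℝ, Phase) poincareMap (covering p) v =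
      fderiv ℝ (poincareMap ∘ covering) p v := by
  have h1 : HasMFDerivAt coordModel 𝓘(ℝ, Phase) poincareMap (covering p)
      (mfderiv coordModel 𝓘(ℝ, Phase) poincareMap (covering p)) :=
    ((contMDiffAt_poincareMap (z := covering p) hp).mdifferentiableAt (by simp)).hasMFDerivAt
  generalize mfderiv coordModel 𝓘(ℝ, Phase) poincareMap (covering p) = A at h1 ⊢
  have h2 : HasMFDerivAt (𝓘(ℝ, ℝ).prod 𝓘(ℝ, ℝ × ℝ × ℝ)) coordModel covering p
      (((ContinuousLinearMap.id ℝ ℝ).comp (ContinuousLinearMap.fst ℝ ℝ (ℝ × ℝ × ℝ))).prod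
        (ContinuousLinearMap.snd ℝ ℝ (ℝ × ℝ × ℝ))) :=
    ((hasMFDerivAt_angleCoe p.1).comp p (hasMFDerivAt_fst p)).prodMk (hasMFDerivAt_snd p)
  have h3 := h1.comp p h2
  rw [← modelWithCornersSelf_prod, ← chartedSpaceSelf_prod] at h3
  have h4 : HasFDerivAt (poincareMap ∘ covering) (fderiv ℝ (poincareMap ∘ covering) p) p :=
    ((contDiffAt_poincareMap_covering hp).differentiableAt (by simp)).hasFDerivAt
  have h5 := h4.unique h3.hasFDerivAt
  exact (DFunLike.congr_fun h5 v).symm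

/-! ### The global diffeomorphism. -/

/-- The Poincaré map as an equivalence of `Ω` with `𝓔₊`. -/
def poincareEquiv : domain ≃ ellipticRegion := poincareMap_bijOn.equiv poincareMap

lemma poincareEquiv_apply (z : domain) : (poincareEquiv z : Phase) = poincareMap z := rfl

lemma contMDiff_poincareEquiv : ContMDiff coordModel 𝓘(ℝ, Phase) ω poincareEquiv := by
  intro z
  apply contMDiffAt_of_subtypeVal_comp
  exact contMDiffAt_subtype_iff.mpr (contMDiffAt_poincareMap z.2)

/-- A local analytic right inverse of the lift, projected to 𝕋 × ℝ³, picks preimages in Ω;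
injectivity of 𝓟 on Ω forces it to be the global inverse. -/
lemma contMDiff_poincareEquiv_symm : ContMDiff 𝓘(ℝ, Phase) coordModel ω poincareEquiv.symm := by
  intro y
  apply contMDiffAt_of_subtypeVal_comp
  obtain ⟨z, rfl⟩ := poincareEquiv.surjective y
  obtain ⟨p, hp⟩ := exists_covering_eq z
  have hps : p.2 ∈ shapeSet := by
    have := z.2
    rw [← hp] at this
    exact this
  obtain ⟨g, hg, hgp, hgr⟩ := exists_contDiffAt_rightInverse (by simp)
    (contDiffAt_poincareMap_covering hps) (fderiv_poincareMap_covering_injective hps)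
  have hy : (poincareMap ∘ covering) p = (poincareEquiv z : Phase) := by
    rw [poincareEquiv_apply, Function.comp_apply, hp]
  -- Injectivity is known only on Ω, so the local inverse has to stay in it.
  have hev : ∀ᶠ y in nhds ((poincareMap ∘ covering) p), (g y).2 ∈ shapeSet :=
    hg.continuousAt.eventually (by rw [hgp]; exact eventually_mem_shapeSet hps)
  rw [hy] at hg hgr hev
  have h1 : ContMDiffAt 𝓘(ℝ, Phase) coordModel ω (covering ∘ g) (poincareEquiv z : Phase) :=
    contMDiff_covering.contMDiffAt.comp _ hg.contMDiffAt
  refine (contMDiffAt_subtype_iff.mpr h1).congr_of_eventuallyEq ?_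
  have h2 := continuous_subtype_val.continuousAt.eventually (hgr.and hev)
  filter_upwards [h2] with y hy
  obtain ⟨hy1, hy2⟩ := hy
  refine poincareMap_bijOn.injOn (poincareEquiv.symm y).2 hy2 ?_
  rw [Function.comp_apply, ← poincareEquiv_apply, Equiv.apply_symm_apply]
  exact hy1.symm

/-- The Poincaré map as an analytic diffeomorphism. -/
def poincareDiffeomorph : domain ≃ₘ^ω⟮coordModel, 𝓘(ℝ, Phase)⟯ ellipticRegion where
  toEquiv := poincareEquiv
  contMDiff_toFun := contMDiff_poincareEquiv
  contMDiff_invFun := contMDiff_poincareEquiv_symm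

lemma poincareMap_symplectic {z : Coord} (hz : z ∈ domain) (v w : TangentSpace coordModel z) :
    phaseForm (poincareMap z) (mfderiv coordModel 𝓘(ℝ, Phase) poincareMap z v)
        (mfderiv coordModel 𝓘(ℝ, Phase) poincareMap z w) = coordForm z v w := by
  obtain ⟨p, rfl⟩ := exists_covering_eq z
  have h1 := mfderiv_poincareMap (p := p) hz v
  have h2 := mfderiv_poincareMap (p := p) hz w
  rw [h1, h2]
  exact fderiv_poincareMap_covering_symplectic _ hz v w

end PoincareCoordinates

end

theorem proposition3p1 :
    ∃ Φ : PoincareCoordinates.domain ≃ₘ^ω⟮PoincareCoordinates.coordModel,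
        𝓘(ℝ, PoincareCoordinates.Phase)⟯ PoincareCoordinates.ellipticRegion,
      (∀ z : PoincareCoordinates.domain,
        (Φ z : PoincareCoordinates.Phase) = PoincareCoordinates.poincareMap z) ∧
      ∀ (z : PoincareCoordinates.domain)
        (v w : TangentSpace PoincareCoordinates.coordModel (z : PoincareCoordinates.Coord)),
        PoincareCoordinates.phaseForm (PoincareCoordinates.poincareMap z)
            (mfderiv PoincareCoordinates.coordModel 𝓘(ℝ, PoincareCoordinates.Phase)
              PoincareCoordinates.poincareMap z v)
            (mfderiv PoincareCoordinates.coordModel 𝓘(ℝ, PoincareCoordinates.Phase)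
              PoincareCoordinates.poincareMap z w) =
          PoincareCoordinates.coordForm z v w :=
  ⟨PoincareCoordinates.poincareDiffeomorph, PoincareCoordinates.poincareEquiv_apply,
    fun z => PoincareCoordinates.poincareMap_symplectic z.2⟩
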